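/- Let $n\ge 1$ and let $M=e^{-V}$ be a positive $C^2$ function on $\mathbb{R}^n$ with $M\in L^1(\mathbb{R}^n)$. Assume that there exists $\varepsilon>0$ such that $$\frac{(1-\varepsilon)\,|\nabla V(x)|^2}{2}-\Delta V(x)\longrightarrow+\infty\qquad\text{as } |x|\to\infty .$$ Let $L^2(\mathbb{R}^n,M)$ be the space of measurable real-valued functions that are square integrable with respect to $M(x)\,dx$, let $L^2_0(\mathbb{R}^n,M)$ be the subspace of those $f\in L^2(\mathbb{R}^n,M)$ with $\int_{\mathbb{R}^n} f(x)\,M(x)\,dx=0$, and let $H^1(\mathbb{R}^n,M)$ be the space of those $f\in L^2(\mathbb{R}^n,M)$ whose weak gradient $\nabla f$ belongs to $L^2(\mathbb{R}^n,M)$. Then there exists a constant $\lambda'(M)>0$ such that, for every $f\in L^2_0(\mathbb{R}^n,M)\cap H^1(\mathbb{R}^n,M)$, $$\int_{\mathbb{R}^n}|\nabla f(x)|^2\,M(x)\,dx\;\ge\;\lambda'(M)\int_{\mathbb{R}^n}|f(x)|^2\left(1+|\nabla\ln M(x)|^2\right)M(x)\,dx ,$$ where both integrals are finite. -/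

import Mathlib

open MeasureTheory Filter
open scoped ContDiff

namespace WeightedSobolev

/-- The measure `M(x) dx` on `ℝⁿ`. -/
noncomputable def weightedMeasure {n : ℕ} (M : EuclideanSpace ℝ (Fin n) → ℝ) :
    Measure (EuclideanSpace ℝ (Fin n)) :=
  volume.withDensity fun x => ENNReal.ofReal (M x)

/-- `f ∈ L²₀(ℝⁿ, M)`: `f` is measurable, square integrable with respect to `M(x) dx`, and
`∫ f(x) M(x) dx = 0`. -/
def MemL20 {n : ℕ} (M f : EuclideanSpace ℝ (Fin n) → ℝ) : Prop :=
  MemLp f 2 (weightedMeasure M) ∧ ∫ x, f x * M x = 0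

/-- `g` is a weak gradient of `f` on `ℝⁿ` (with respect to Lebesgue measure): both are locally
integrable and `∫ f ∂ᵢφ = - ∫ gᵢ φ` for all `φ ∈ C_c^∞(ℝⁿ)` and all `i`. -/
def IsWeakGradient {n : ℕ} (f : EuclideanSpace ℝ (Fin n) → ℝ)
    (g : EuclideanSpace ℝ (Fin n) → EuclideanSpace ℝ (Fin n)) : Prop :=
  LocallyIntegrable f ∧ LocallyIntegrable g ∧
    ∀ φ : EuclideanSpace ℝ (Fin n) → ℝ, ContDiff ℝ ∞ φ → HasCompactSupport φ →
      ∀ i : Fin n,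
        ∫ x, f x * fderiv ℝ φ x (EuclideanSpace.single i 1) = - ∫ x, g x i * φ x

/-- `f ∈ H¹(ℝⁿ, M)`: `f ∈ L²(ℝⁿ, M)` has a weak gradient that belongs to `L²(ℝⁿ, M)`. -/
def MemH1 {n : ℕ} (M f : EuclideanSpace ℝ (Fin n) → ℝ) : Prop :=
  MemLp f 2 (weightedMeasure M) ∧
    ∃ g : EuclideanSpace ℝ (Fin n) → EuclideanSpace ℝ (Fin n),
      IsWeakGradient f g ∧ MemLp g 2 (weightedMeasure M)

end WeightedSobolev

namespace WeightedSobolev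
open scoped Topology ENNReal Convolution

/-! Put `W = (1-ε)|∇V|²/2 - ΔV`. Since `ΔM = (|∇V|² - ΔV) M`, integrating by parts against `f²`
gives `∫ f² (|∇V|² - ΔV) M = 2 ∫ f ∇f·∇V M`. Young's inequality absorbs a fraction `a ≥ 1/2` of `∫
f² |∇V|² M` on the left; with `a = 1/2 + ε/4` what remains is `∫ f² (W + (ε/4)|∇V|²) M ≤ 4 ∫ |∇f|²
M` (`IsWeakGradient.energy_estimate`, where a constant `K` with `W + K ≥ 0` is added on both sides).

This estimate is used twice. Applied to `f - c`, it controls the mass outside a ball beyond which `W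
≥ 1`; inside the ball `M` is bounded above and below, and the unweighted inequality
`IsWeakGradient.poincare_closedBall` applies. The outcome is `exists_weighted_poincare`, and for
mean-zero `f` replacing `c` by `0` only decreases the left side. Applied to `f` itself, with `∫ f²
M` now under control, it bounds `∫ f² |∇V|² M`.

As `f` is only weakly differentiable, integration by parts and the local Poincaré inequality are
proved for smooth functions and passed to the limit along mollifications. Cutoffs supply compact
support; Fatou's lemma removes them and yields integrability. -/

theorem eLpNorm_two_sq {α F : Type*} [MeasurableSpace α] [NormedAddCommGroup F] (μ : Measure α)
    (f : α → F) : eLpNorm f 2 μ ^ 2 = ∫⁻ x, ‖f x‖ₑ ^ 2 ∂μ := by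
  have h := eLpNorm_nnreal_pow_eq_lintegral (μ := μ) (f := f) (p := 2) (by norm_num)
  have e : ((2 : NNReal) : ℝ) = ((2 : ℕ) : ℝ) := by norm_num
  simp only [e, ENNReal.rpow_natCast] at h
  exact h

/-! ### Mollification in `L²`, globally and on balls. -/

section Mollification

variable {E : Type*} [NormedAddCommGroup E] [InnerProductSpace ℝ E] [FiniteDimensional ℝ E]
  [MeasurableSpace E] [BorelSpace E]

/-- Convolution of `u` with the normalized bump function `φ`. -/
noncomputable def mollify (φ : ContDiffBump (0 : E)) (u : E → ℝ) : E → ℝ :=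
  φ.normed volume ⋆[ContinuousLinearMap.lsmul ℝ ℝ, volume] u

theorem mollify_apply (φ : ContDiffBump (0 : E)) (u : E → ℝ) (x : E) :
    mollify φ u x = ∫ t, φ.normed volume t * u (x - t) := rfl

theorem lintegral_normed_eq_one (φ : ContDiffBump (0 : E)) :
    ∫⁻ t, ENNReal.ofReal (φ.normed volume t) = 1 := by
  rw [← ofReal_integral_eq_lintegral_ofReal φ.integrable_normed
    (Eventually.of_forall φ.nonneg_normed), φ.integral_normed, ENNReal.ofReal_one]

theorem measurable_ofReal_normed (φ : ContDiffBump (0 : E)) :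
    Measurable fun t : E => ENNReal.ofReal (φ.normed volume t) :=
  (φ.continuous_normed.measurable).ennreal_ofReal

/-- Jensen's inequality: mollifying averages against a probability measure, for which the `L¹` norm
is at most the `L²` norm. -/
theorem enorm_mollify_sq_le (φ : ContDiffBump (0 : E)) {u : E → ℝ} (hu : Measurable u) (x : E) :
    ‖mollify φ u x‖ₑ ^ 2 ≤ ∫⁻ t, ENNReal.ofReal (φ.normed volume t) * ‖u (x - t)‖ₑ ^ 2 := by
  have hρ := measurable_ofReal_normed φ
  set ν : Measure E := volume.withDensity fun t => ENNReal.ofReal (φ.normed volume t) with hν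
  have : IsProbabilityMeasure ν := ⟨by
    rw [hν, withDensity_apply _ MeasurableSet.univ, Measure.restrict_univ,
      lintegral_normed_eq_one]⟩
  have hux : Measurable fun t => u (x - t) := hu.comp (measurable_const.sub measurable_id)
  have h1 : ‖mollify φ u x‖ₑ ≤ eLpNorm (fun t => u (x - t)) 1 ν := by
    rw [mollify_apply, eLpNorm_one_eq_lintegral_enorm, hν,
      lintegral_withDensity_eq_lintegral_mul _ hρ hux.enorm]
    refine (enorm_integral_le_lintegral_enorm _).trans (le_of_eq (lintegral_congr fun t => ?_))
    rw [enorm_mul, Real.enorm_of_nonneg (φ.nonneg_normed t)]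
    rfl
  have h2 := h1.trans (eLpNorm_le_eLpNorm_of_exponent_le (p := 1) (q := 2) (by norm_num)
    hux.aestronglyMeasurable)
  calc ‖mollify φ u x‖ₑ ^ 2 ≤ eLpNorm (fun t => u (x - t)) 2 ν ^ 2 := by gcongr
    _ = _ := by
      rw [eLpNorm_two_sq, hν, lintegral_withDensity_eq_lintegral_mul _ hρ (hux.enorm.pow_const 2)]
      rfl

/-- Integrate the pointwise Jensen bound, swap by Tonelli and use translation invariance; passing to
a measurable representative does not change the convolution. -/
theorem eLpNorm_mollify_le (φ : ContDiffBump (0 : E)) {u : E → ℝ}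
    (hu : AEStronglyMeasurable u volume) :
    eLpNorm (mollify φ u) 2 volume ≤ eLpNorm u 2 volume := by
  have hcongr : mollify φ u = mollify φ (hu.mk u) :=
    convolution_congr _ Filter.EventuallyEq.rfl hu.ae_eq_mk
  rw [hcongr, eLpNorm_congr_ae hu.ae_eq_mk]
  have hv : Measurable (hu.mk u) := hu.stronglyMeasurable_mk.measurable
  generalize hu.mk u = v at hv
  have hρ := measurable_ofReal_normed φ
  rw [← ENNReal.pow_le_pow_left_iff (n := 2) (by norm_num), eLpNorm_two_sq, eLpNorm_two_sq]
  calc ∫⁻ x, ‖mollify φ v x‖ₑ ^ 2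
      ≤ ∫⁻ x, ∫⁻ t, ENNReal.ofReal (φ.normed volume t) * ‖v (x - t)‖ₑ ^ 2 :=
        lintegral_mono fun x => enorm_mollify_sq_le φ hv x
    _ = ∫⁻ t, ∫⁻ x, ENNReal.ofReal (φ.normed volume t) * ‖v (x - t)‖ₑ ^ 2 := by
        refine lintegral_lintegral_swap (Measurable.aemeasurable ?_)
        exact (hρ.comp measurable_snd).mul
          ((hv.comp (measurable_fst.sub measurable_snd)).enorm.pow_const 2)
    _ = ∫⁻ t : E, ENNReal.ofReal (φ.normed volume t) * ∫⁻ x, ‖v x‖ₑ ^ 2 := by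
        refine lintegral_congr fun t => ?_
        rw [lintegral_const_mul' _ _ ENNReal.ofReal_ne_top,
          lintegral_sub_right_eq_self (fun x => ‖v x‖ₑ ^ 2) t]
    _ = ∫⁻ x, ‖v x‖ₑ ^ 2 := by
        rw [lintegral_mul_const _ hρ, lintegral_normed_eq_one, one_mul]

theorem LocallyIntegrable.convolutionExists_normed (φ : ContDiffBump (0 : E)) {u : E → ℝ}
    (hu : LocallyIntegrable u volume) :
    ConvolutionExists (φ.normed volume) u (ContinuousLinearMap.lsmul ℝ ℝ) volume :=
  φ.hasCompactSupport_normed.convolutionExists_left _ φ.continuous_normed hu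

theorem mollify_sub (φ : ContDiffBump (0 : E)) {u v : E → ℝ}
    (hu : LocallyIntegrable u volume) (hv : LocallyIntegrable v volume) :
    mollify φ (u - v) = mollify φ u - mollify φ v := by
  ext x
  have h1 : Integrable (fun t => φ.normed volume t * u (x - t)) :=
    LocallyIntegrable.convolutionExists_normed φ hu x
  have h2 : Integrable (fun t => φ.normed volume t * v (x - t)) :=
    LocallyIntegrable.convolutionExists_normed φ hv x
  simp only [Pi.sub_apply, mollify_apply, mul_sub]
  exact integral_sub h1 h2

theorem mollify_congr_of_eqOn (φ : ContDiffBump (0 : E)) {u v : E → ℝ} {x : E}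
    (h : ∀ y ∈ Metric.ball x φ.rOut, u y = v y) : mollify φ u x = mollify φ v x := by
  rw [mollify_apply, mollify_apply]
  refine integral_congr_ae (Eventually.of_forall fun t => ?_)
  by_cases ht : t ∈ Function.support (φ.normed volume)
  · have : x - t ∈ Metric.ball x φ.rOut := by
      rw [φ.support_normed_eq] at ht
      simpa [dist_eq_norm] using ht
    simp only [h _ this]
  · simp [Function.notMem_support.mp ht]

theorem tendsto_eLpNorm_mollify_sub_of_continuous {ι : Type*} {l : Filter ι}
    {φ : ι → ContDiffBump (0 : E)} (hφ : Tendsto (fun i => (φ i).rOut) l (𝓝 0)) {g : E → ℝ}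
    (hg : Continuous g) (hgc : HasCompactSupport g) :
    Tendsto (fun i => eLpNorm (mollify (φ i) g - g) 2 volume) l (𝓝 0) := by
  set K : Set E := Metric.cthickening 1 (tsupport g) with hK
  have hKc : IsCompact K := hgc.isCompact.cthickening
  have huc : UniformContinuous g := hg.uniformContinuous_of_tendsto_cocompact
    (hgc.is_zero_at_infty)
  have hlim : Tendsto (fun c : ℝ => ENNReal.ofReal c * volume K ^ (1 / (2 : ℝ≥0∞).toReal))
      (𝓝 0) (𝓝 0) := by
    have h1 : Tendsto (fun c : ℝ => ENNReal.ofReal c) (𝓝 0) (𝓝 0) := by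
      simpa using ENNReal.tendsto_ofReal (tendsto_id (α := ℝ) (x := 𝓝 0))
    have h2 : volume K ^ (1 / (2 : ℝ≥0∞).toReal) ≠ ⊤ :=
      ENNReal.rpow_ne_top_of_nonneg (by simp) hKc.measure_lt_top.ne
    simpa using ENNReal.Tendsto.mul_const h1 (Or.inr h2)
  rw [ENNReal.tendsto_nhds_zero]
  intro ε hε
  obtain ⟨c, hcε, hc⟩ : ∃ c : ℝ,
      ENNReal.ofReal c * volume K ^ (1 / (2 : ℝ≥0∞).toReal) ≤ ε ∧ 0 < c :=
    (((ENNReal.tendsto_nhds_zero.mp (hlim.mono_left nhdsWithin_le_nhds)) ε hε).and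
      (self_mem_nhdsWithin (a := (0 : ℝ)) (s := Set.Ioi 0))).exists
  obtain ⟨δ, hδ, hδg⟩ := Metric.uniformContinuous_iff.mp huc c hc
  filter_upwards [hφ.eventually (gt_mem_nhds hδ), hφ.eventually (gt_mem_nhds one_pos)]
    with i hi hi1
  refine le_trans (eLpNorm_sub_le_of_dist_bdd volume (by norm_num) hKc.measurableSet hc.le
    (s := K) (fun x => ?_) ?_ ?_) hcε
  · exact ContDiffBump.dist_normed_convolution_le hg.aestronglyMeasurable
      fun y hy => (hδg ((Metric.mem_ball.mp hy).trans hi)).le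
  · intro x hx
    by_contra hxK
    refine hx ?_
    rw [mollify_congr_of_eqOn (v := 0) (φ i) (fun y hy => ?_)]
    · simp [mollify_apply]
    · by_contra hy0
      exact hxK (Metric.mem_cthickening_of_dist_le x y 1 _ (subset_tsupport g hy0)
        ((dist_comm x y).trans_le ((Metric.mem_ball.mp hy).trans hi1).le))
  · exact (subset_tsupport g).trans (Metric.self_subset_cthickening _)

/-- Density of compactly supported continuous functions, for which convergence is uniform, together
with the `L²` contraction property. -/
theorem tendsto_eLpNorm_mollify_sub {ι : Type*} {l : Filter ι}
    {φ : ι → ContDiffBump (0 : E)} (hφ : Tendsto (fun i => (φ i).rOut) l (𝓝 0)) {u : E → ℝ}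
    (hu : MemLp u 2 volume) :
    Tendsto (fun i => eLpNorm (mollify (φ i) u - u) 2 volume) l (𝓝 0) := by
  rw [ENNReal.tendsto_nhds_zero]
  intro ε hε
  have hε3 : ε / 3 ≠ 0 := (ENNReal.div_pos hε.ne' (by norm_num)).ne'
  obtain ⟨g, hgc, hug, hg, hgL⟩ := hu.exists_hasCompactSupport_eLpNorm_sub_le (by norm_num) hε3
  filter_upwards [ENNReal.tendsto_nhds_zero.mp
    (tendsto_eLpNorm_mollify_sub_of_continuous hφ hg hgc) (ε / 3) hε3.bot_lt] with i hi
  have hul := hu.locallyIntegrable (by norm_num)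
  have hgl := hgL.locallyIntegrable (by norm_num)
  have hdiff := hu.aestronglyMeasurable.sub hgL.aestronglyMeasurable
  have hdecomp : mollify (φ i) u - u
      = mollify (φ i) (u - g) + ((mollify (φ i) g - g) + (g - u)) := by
    rw [mollify_sub _ hul hgl]; abel
  have hm : ∀ {w : E → ℝ}, LocallyIntegrable w volume →
      AEStronglyMeasurable (mollify (φ i) w) volume := fun hw =>
    ((φ i).hasCompactSupport_normed.continuous_convolution_left _ (φ i).continuous_normed
      hw).aestronglyMeasurable
  rw [hdecomp]
  calc _ ≤ eLpNorm (mollify (φ i) (u - g)) 2 volume + (eLpNorm (mollify (φ i) g - g) 2 volume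
        + eLpNorm (g - u) 2 volume) := by
        refine (eLpNorm_add_le (hm (hul.sub hgl))
          (((hm hgl).sub hgL.aestronglyMeasurable).add
            (hgL.aestronglyMeasurable.sub hu.aestronglyMeasurable)) (by norm_num)).trans ?_
        gcongr
        exact eLpNorm_add_le ((hm hgl).sub hgL.aestronglyMeasurable)
          (hgL.aestronglyMeasurable.sub hu.aestronglyMeasurable) (by norm_num)
    _ ≤ ε / 3 + (ε / 3 + ε / 3) := by
        gcongr
        · exact (eLpNorm_mollify_le _ hdiff).trans hug
        · rw [eLpNorm_sub_comm]; exact hug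
    _ = ε := by rw [← add_assoc, ENNReal.add_thirds]

theorem tendsto_eLpNorm_mollify_sub_restrict {ι : Type*} {l : Filter ι}
    {φ : ι → ContDiffBump (0 : E)} (hφ : Tendsto (fun i => (φ i).rOut) l (𝓝 0)) {u : E → ℝ}
    (hu : ∀ r : ℝ, MemLp u 2 (volume.restrict (Metric.closedBall 0 r))) (R : ℝ) :
    Tendsto (fun i => eLpNorm (mollify (φ i) u - u) 2
      (volume.restrict (Metric.closedBall 0 R))) l (𝓝 0) := by
  -- Once the bump radius is below `1`, mollification on the ball of radius `R` only sees `u` on the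
  -- ball of radius `R + 1`.
  set v : E → ℝ := (Metric.closedBall (0 : E) (R + 1)).indicator u with hv
  have hvL : MemLp v 2 volume :=
    (memLp_indicator_iff_restrict Metric.isClosed_closedBall.measurableSet).mpr (hu (R + 1))
  refine tendsto_of_tendsto_of_tendsto_of_le_of_le' tendsto_const_nhds
    (tendsto_eLpNorm_mollify_sub hφ hvL) (Eventually.of_forall fun _ => zero_le) ?_
  filter_upwards [hφ.eventually (gt_mem_nhds one_pos)] with i hi
  have hcongr : eLpNorm (mollify (φ i) u - u) 2 (volume.restrict (Metric.closedBall 0 R))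
      = eLpNorm (mollify (φ i) v - v) 2 (volume.restrict (Metric.closedBall 0 R)) := by
    refine eLpNorm_congr_ae ((ae_restrict_mem
      Metric.isClosed_closedBall.measurableSet).mono fun x hx => ?_)
    have hx' : ‖x‖ ≤ R := by simpa using hx
    have huv : ∀ y, ‖y‖ ≤ R + 1 → u y = v y := fun y hy => by
      rw [hv, Set.indicator_of_mem (by simpa using hy)]
    simp only [Pi.sub_apply]
    rw [← huv x (by linarith), mollify_congr_of_eqOn (v := v) (φ i) fun y hy => huv y ?_]
    have h1 : ‖y - x‖ < (φ i).rOut := by simpa [dist_eq_norm] using hy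
    have h2 := norm_add_le (y - x) x
    rw [sub_add_cancel] at h2
    linarith
  rw [hcongr]
  exact eLpNorm_mono_measure _ Measure.restrict_le_self

end Mollification

/-! ### `L²` limits of products, and integration by parts for weak gradients. -/

theorem tendsto_integral_mul_of_tendsto_eLpNorm {α ι : Type*} [MeasurableSpace α] {μ : Measure α}
    {l : Filter ι} {a b : ι → α → ℝ} {a₀ b₀ : α → ℝ}
    (ha : ∀ i, MemLp (a i) 2 μ) (hb : ∀ i, MemLp (b i) 2 μ) (ha₀ : MemLp a₀ 2 μ)
    (hb₀ : MemLp b₀ 2 μ) (hal : Tendsto (fun i => eLpNorm (a i - a₀) 2 μ) l (𝓝 0))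
    (hbl : Tendsto (fun i => eLpNorm (b i - b₀) 2 μ) l (𝓝 0)) :
    Tendsto (fun i => ∫ x, a i x * b i x ∂μ) l (𝓝 (∫ x, a₀ x * b₀ x ∂μ)) := by
  have key : ∀ {u v : α → ℝ} (hu : MemLp u 2 μ) (hv : MemLp v 2 μ),
      ∫ x, u x * v x ∂μ = inner ℝ (hu.toLp u) (hv.toLp v) := by
    intro u v hu hv
    rw [L2.inner_def]
    refine integral_congr_ae ?_
    filter_upwards [hu.coeFn_toLp, hv.coeFn_toLp] with x hx hy
    rw [hx, hy]
    simp [mul_comm]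
  have hA := (Lp.tendsto_Lp_iff_tendsto_eLpNorm'' a ha a₀ ha₀).mpr hal
  have hB := (Lp.tendsto_Lp_iff_tendsto_eLpNorm'' b hb b₀ hb₀).mpr hbl
  simpa only [key (ha _) (hb _), key ha₀ hb₀] using hA.inner hB

theorem tendsto_integral_mul_mul_of_tendsto_eLpNorm {α ι : Type*} [MeasurableSpace α]
    {μ : Measure α} {l : Filter ι} {a b : ι → α → ℝ} {a₀ b₀ w : α → ℝ} {C : ℝ}
    (ha : ∀ i, MemLp (a i) 2 μ) (hb : ∀ i, MemLp (b i) 2 μ) (ha₀ : MemLp a₀ 2 μ)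
    (hb₀ : MemLp b₀ 2 μ) (hw : AEStronglyMeasurable w μ) (hwC : ∀ x, ‖w x‖ ≤ C)
    (hal : Tendsto (fun i => eLpNorm (a i - a₀) 2 μ) l (𝓝 0))
    (hbl : Tendsto (fun i => eLpNorm (b i - b₀) 2 μ) l (𝓝 0)) :
    Tendsto (fun i => ∫ x, a i x * (b i x * w x) ∂μ) l (𝓝 (∫ x, a₀ x * (b₀ x * w x) ∂μ)) := by
  have hmul : ∀ {v : α → ℝ}, MemLp v 2 μ → MemLp (fun x => v x * w x) 2 μ := fun hv =>
    hv.of_le_mul (c := C) (hv.aestronglyMeasurable.mul hw) (Eventually.of_forall fun x => by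
      rw [norm_mul, mul_comm]; gcongr; exact hwC x)
  refine tendsto_integral_mul_of_tendsto_eLpNorm ha (fun i => hmul (hb i)) ha₀ (hmul hb₀) hal ?_
  have h0 : Tendsto (fun i => ENNReal.ofReal C * eLpNorm (b i - b₀) 2 μ) l (𝓝 0) := by
    simpa using ENNReal.Tendsto.const_mul hbl (Or.inr ENNReal.ofReal_ne_top)
  refine tendsto_of_tendsto_of_tendsto_of_le_of_le tendsto_const_nhds h0
    (fun _ => zero_le) fun i => ?_
  refine eLpNorm_le_mul_eLpNorm_of_ae_le_mul (Eventually.of_forall fun x => ?_) _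
  simp only [Pi.sub_apply]
  rw [← sub_mul, norm_mul, mul_comm]
  gcongr
  exact hwC x

variable {n : ℕ}

theorem contDiff_mollify (φ : ContDiffBump (0 : EuclideanSpace ℝ (Fin n)))
    {f : EuclideanSpace ℝ (Fin n) → ℝ} (hf : LocallyIntegrable f volume) :
    ContDiff ℝ ∞ (mollify φ f) :=
  φ.hasCompactSupport_normed.contDiff_convolution_left _ φ.contDiff_normed hf

/-- The derivative falls on the kernel, and `t ↦ ρ (x - t)` is an admissible test function; the sign
from the reflection cancels the one in the weak formulation. -/
theorem IsWeakGradient.fderiv_mollify {f : EuclideanSpace ℝ (Fin n) → ℝ}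
    {g : EuclideanSpace ℝ (Fin n) → EuclideanSpace ℝ (Fin n)} (h : IsWeakGradient f g)
    (φ : ContDiffBump (0 : EuclideanSpace ℝ (Fin n))) (x : EuclideanSpace ℝ (Fin n)) (i : Fin n) :
    fderiv ℝ (mollify φ f) x (EuclideanSpace.single i 1) = mollify φ (fun y => g y i) x := by
  obtain ⟨hf, -, hfg⟩ := h
  set e : EuclideanSpace ℝ (Fin n) := EuclideanSpace.single i 1
  set ρ : EuclideanSpace ℝ (Fin n) → ℝ := φ.normed volume with hρ
  have hρs : ContDiff ℝ ∞ ρ := φ.contDiff_normed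
  have hρ1 : ContDiff ℝ 1 ρ := φ.contDiff_normed
  have hρc : HasCompactSupport ρ := φ.hasCompactSupport_normed
  have hd := (hρc.hasFDerivAt_convolution_left (ContinuousLinearMap.lsmul ℝ ℝ) hρ1 hf x).fderiv
  have hint : ConvolutionExistsAt (fderiv ℝ ρ) f x
      (ContinuousLinearMap.precompL _ (ContinuousLinearMap.lsmul ℝ ℝ)) volume :=
    (hρc.fderiv ℝ).convolutionExists_left _ (hρ1.continuous_fderiv one_ne_zero) hf x
  have h1 : fderiv ℝ (mollify φ f) x e = ∫ t, fderiv ℝ ρ t e * f (x - t) := by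
    change fderiv ℝ (ρ ⋆[ContinuousLinearMap.lsmul ℝ ℝ, volume] f) x e = _
    rw [hd, convolution_def, ContinuousLinearMap.integral_apply hint]
    rfl
  have hψd : ∀ t, fderiv ℝ (fun t => ρ (x - t)) t e = - fderiv ℝ ρ (x - t) e := by
    intro t
    have hs : HasFDerivAt (fun t : EuclideanSpace ℝ (Fin n) => x - t)
        (-ContinuousLinearMap.id ℝ _) t := (hasFDerivAt_id t).const_sub x
    have := ((hρ1.differentiable one_ne_zero (x - t)).hasFDerivAt.comp t hs).fderiv
    rw [show (fun t => ρ (x - t)) = ρ ∘ fun t => x - t from rfl, this]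
    simp
  have h2 := hfg (fun t => ρ (x - t)) (hρs.comp (contDiff_const.sub contDiff_id))
    (hρc.comp_homeomorph (Homeomorph.subLeft x)) i
  simp only [hψd, mul_neg, integral_neg, neg_inj, e] at h2
  rw [h1, ← integral_sub_left_eq_self _ volume x, mollify_apply,
    ← integral_sub_left_eq_self (fun t => φ.normed volume t * _) volume x]
  simp only [sub_sub_cancel]
  simpa only [mul_comm] using h2

theorem memLp_apply {α : Type*} [MeasurableSpace α] {μ : Measure α} {p : ℝ≥0∞}
    {g : α → EuclideanSpace ℝ (Fin n)} (hg : MemLp g p μ) (i : Fin n) :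
    MemLp (fun x => g x i) p μ :=
  hg.of_le ((EuclideanSpace.proj (𝕜 := ℝ) i).continuous.comp_aestronglyMeasurable
    hg.aestronglyMeasurable) (Eventually.of_forall fun x => PiLp.norm_apply_le (g x) i)

theorem _root_.Continuous.memLp_restrict_closedBall {u : EuclideanSpace ℝ (Fin n) → ℝ}
    (hu : Continuous u) (r : ℝ) : MemLp u 2 (volume.restrict (Metric.closedBall 0 r)) := by
  obtain ⟨C, hC⟩ := (isCompact_closedBall (0 : EuclideanSpace ℝ (Fin n)) r).exists_bound_of_continuousOn
    hu.continuousOn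
  have : IsFiniteMeasure (volume.restrict (Metric.closedBall (0 : EuclideanSpace ℝ (Fin n)) r)) :=
    ⟨by simpa using (isCompact_closedBall (0 : EuclideanSpace ℝ (Fin n)) r).measure_lt_top⟩
  exact MemLp.of_bound hu.aestronglyMeasurable C
    ((ae_restrict_mem Metric.isClosed_closedBall.measurableSet).mono fun x hx => hC x hx)

/-- A sequence of bump functions shrinking to the origin. -/
noncomputable def shrinkingBump (n k : ℕ) : ContDiffBump (0 : EuclideanSpace ℝ (Fin n)) where
  rIn := 1 / (2 * ((k : ℝ) + 1))
  rOut := 1 / ((k : ℝ) + 1)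
  rIn_pos := by positivity
  rIn_lt_rOut := by
    apply one_div_lt_one_div_of_lt <;> nlinarith [(Nat.cast_nonneg k : (0 : ℝ) ≤ k)]

theorem tendsto_rOut_shrinkingBump (n : ℕ) :
    Tendsto (fun k => (shrinkingBump n k).rOut) atTop (𝓝 0) :=
  tendsto_one_div_add_atTop_nhds_zero_nat

/-- Functions with a weak gradient, both locally square integrable, are locally approximated by
smooth functions in the Sobolev sense. -/
theorem IsWeakGradient.exists_smooth_approx {f : EuclideanSpace ℝ (Fin n) → ℝ}
    {g : EuclideanSpace ℝ (Fin n) → EuclideanSpace ℝ (Fin n)} (h : IsWeakGradient f g)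
    (hf : ∀ r : ℝ, MemLp f 2 (volume.restrict (Metric.closedBall 0 r)))
    (hg : ∀ r : ℝ, MemLp g 2 (volume.restrict (Metric.closedBall 0 r))) :
    ∃ u : ℕ → EuclideanSpace ℝ (Fin n) → ℝ, (∀ k, ContDiff ℝ ∞ (u k)) ∧ ∀ R : ℝ,
      Tendsto (fun k => eLpNorm (u k - f) 2 (volume.restrict (Metric.closedBall 0 R)))
        atTop (𝓝 0) ∧
      ∀ i : Fin n, Tendsto (fun k => eLpNorm
        ((fun x => fderiv ℝ (u k) x (EuclideanSpace.single i 1)) - fun x => g x i) 2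
          (volume.restrict (Metric.closedBall 0 R))) atTop (𝓝 0) := by
  refine ⟨fun k => mollify (shrinkingBump n k) f, fun k => contDiff_mollify _ h.1, fun R =>
    ⟨tendsto_eLpNorm_mollify_sub_restrict (tendsto_rOut_shrinkingBump n) hf R, fun i => ?_⟩⟩
  have h1 : ∀ k, (fun x => fderiv ℝ (mollify (shrinkingBump n k) f) x
      (EuclideanSpace.single i 1)) = mollify (shrinkingBump n k) (fun y => g y i) :=
    fun k => funext fun x => h.fderiv_mollify _ x i
  simp only [h1]
  exact tendsto_eLpNorm_mollify_sub_restrict (tendsto_rOut_shrinkingBump n)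
    (fun r => memLp_apply (hg r) i) R

theorem integral_sq_mul_fderiv_eq_of_contDiff {u η : EuclideanSpace ℝ (Fin n) → ℝ}
    (hu : ContDiff ℝ 1 u) (hη : ContDiff ℝ 1 η) (hηc : HasCompactSupport η)
    (e : EuclideanSpace ℝ (Fin n)) :
    ∫ x, u x * (u x * fderiv ℝ η x e) = -2 * ∫ x, u x * (fderiv ℝ u x e * η x) := by
  have hu' : Continuous fun x => fderiv ℝ u x e :=
    (hu.continuous_fderiv one_ne_zero).clm_apply continuous_const
  have hη' : Continuous fun x => fderiv ℝ η x e :=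
    (hη.continuous_fderiv one_ne_zero).clm_apply continuous_const
  have hη'c : HasCompactSupport fun x => fderiv ℝ η x e := hηc.fderiv_apply ℝ e
  have hd : ∀ x, fderiv ℝ (fun y => u y * u y) x e = 2 * (u x * fderiv ℝ u x e) := by
    intro x
    have hx := hu.differentiable one_ne_zero x
    rw [fderiv_fun_mul hx hx]
    simp; ring
  have key := integral_mul_fderiv_eq_neg_fderiv_mul_of_integrable (μ := volume)
    (f := fun y => u y * u y) (g := η) (v := e) ?_ ?_ ?_
    (fun x _ => (hu.mul hu).differentiable one_ne_zero x)
    (fun x _ => hη.differentiable one_ne_zero x)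
  · simp only [hd] at key
    calc _ = ∫ x, u x * u x * fderiv ℝ η x e := by simp only [mul_assoc]
      _ = _ := key
      _ = _ := by rw [neg_mul, ← integral_const_mul]; simp only [mul_assoc]
  · simp only [hd]
    exact Continuous.integrable_of_hasCompactSupport
      ((continuous_const.mul (hu.continuous.mul hu')).mul hη.continuous) hηc.mul_left
  · exact Continuous.integrable_of_hasCompactSupport
      ((hu.continuous.mul hu.continuous).mul hη') hη'c.mul_left
  · exact Continuous.integrable_of_hasCompactSupport
      ((hu.continuous.mul hu.continuous).mul hη.continuous) hηc.mul_left

/-- The chain rule for `f²`, against test functions that are only `C¹`: the later choice of `η`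
contains a first derivative of the `C²` function `V`. Both sides are `L²` limits of the smooth case
on a ball containing the support of `η`. -/
theorem IsWeakGradient.integral_sq_mul_fderiv {f : EuclideanSpace ℝ (Fin n) → ℝ}
    {g : EuclideanSpace ℝ (Fin n) → EuclideanSpace ℝ (Fin n)} (h : IsWeakGradient f g)
    (hf : ∀ r : ℝ, MemLp f 2 (volume.restrict (Metric.closedBall 0 r)))
    (hg : ∀ r : ℝ, MemLp g 2 (volume.restrict (Metric.closedBall 0 r)))
    {η : EuclideanSpace ℝ (Fin n) → ℝ} (hη : ContDiff ℝ 1 η) (hηc : HasCompactSupport η)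
    (i : Fin n) :
    ∫ x, f x * (f x * fderiv ℝ η x (EuclideanSpace.single i 1))
      = -2 * ∫ x, f x * (g x i * η x) := by
  obtain ⟨u, hu, hlim⟩ := h.exists_smooth_approx hf hg
  set e : EuclideanSpace ℝ (Fin n) := EuclideanSpace.single i 1
  have hη' : Continuous fun x => fderiv ℝ η x e :=
    (hη.continuous_fderiv one_ne_zero).clm_apply continuous_const
  have hη'c : HasCompactSupport fun x => fderiv ℝ η x e := hηc.fderiv_apply ℝ e
  obtain ⟨R, hR⟩ := (hηc.isCompact.isBounded.subset_closedBall
    (0 : EuclideanSpace ℝ (Fin n)))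
  have hη0 : ∀ x, x ∉ Metric.closedBall (0 : EuclideanSpace ℝ (Fin n)) R → η x = 0 :=
    fun x hx => image_eq_zero_of_notMem_tsupport fun hx' => hx (hR hx')
  have hη'0 : ∀ x, x ∉ Metric.closedBall (0 : EuclideanSpace ℝ (Fin n)) R →
      fderiv ℝ η x e = 0 := fun x hx => by
    rw [fderiv_of_notMem_tsupport ℝ fun hx' => hx (hR hx')]; rfl
  obtain ⟨C, hC⟩ := hηc.exists_bound_of_continuous hη.continuous
  obtain ⟨C', hC'⟩ := hη'c.exists_bound_of_continuous hη'
  set B := Metric.closedBall (0 : EuclideanSpace ℝ (Fin n)) R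
  have hu1 : ∀ k, ContDiff ℝ 1 (u k) := fun k => (hu k).of_le (by exact_mod_cast le_top)
  have huL : ∀ k, MemLp (u k) 2 (volume.restrict B) := fun k =>
    (hu k).continuous.memLp_restrict_closedBall R
  have hduL : ∀ k, MemLp (fun x => fderiv ℝ (u k) x e) 2 (volume.restrict B) := fun k =>
    Continuous.memLp_restrict_closedBall
      (((hu1 k).continuous_fderiv one_ne_zero).clm_apply continuous_const) R
  have hL : ∀ v : EuclideanSpace ℝ (Fin n) → ℝ,
      ∫ x in B, v x * (v x * fderiv ℝ η x e) = ∫ x, v x * (v x * fderiv ℝ η x e) := fun v =>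
    setIntegral_eq_integral_of_forall_compl_eq_zero fun x hx => by rw [hη'0 x hx]; simp
  have hRt : ∀ v w : EuclideanSpace ℝ (Fin n) → ℝ,
      ∫ x in B, v x * (w x * η x) = ∫ x, v x * (w x * η x) := fun v w =>
    setIntegral_eq_integral_of_forall_compl_eq_zero fun x hx => by rw [hη0 x hx]; simp
  have t1 := tendsto_integral_mul_mul_of_tendsto_eLpNorm (l := atTop) huL huL (hf R) (hf R)
    hη'.aestronglyMeasurable hC' (hlim R).1 (hlim R).1
  have t2 := tendsto_integral_mul_mul_of_tendsto_eLpNorm (l := atTop) huL hduL (hf R)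
    (memLp_apply (hg R) i) hη.continuous.aestronglyMeasurable hC (hlim R).1 ((hlim R).2 i)
  simp only [hL] at t1
  rw [hRt f fun x => g x i] at t2
  simp only [fun k => hRt (u k) fun x => fderiv ℝ (u k) x e] at t2
  simp only [fun k => integral_sq_mul_fderiv_eq_of_contDiff (hu1 k) hη hηc e] at t1
  exact tendsto_nhds_unique t1 (t2.const_mul (-2))


/-! ### Poincaré inequality on balls, by averaging over segments. -/

section SegmentAverage

variable {E : Type*} [NormedAddCommGroup E] [NormedSpace ℝ E] [FiniteDimensional ℝ E]
  [MeasurableSpace E] [BorelSpace E] (μ : Measure E) [μ.IsAddHaarMeasure]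

theorem lintegral_comp_const_add_smul {F : E → ℝ≥0∞} (hF : Measurable F) (c : E) {t : ℝ}
    (ht : t ≠ 0) :
    ∫⁻ y, F (c + t • y) ∂μ = ENNReal.ofReal |(t ^ Module.finrank ℝ E)⁻¹| * ∫⁻ y, F y ∂μ := by
  have h := lintegral_map (μ := μ) (f := fun y => F (c + y)) (g := fun y : E => t • y)
    (hF.comp (measurable_const_add c)) (measurable_const_smul t)
  rw [← h, Measure.map_addHaar_smul μ ht, lintegral_smul_measure, lintegral_add_left_eq_self]
  rfl

theorem lintegral_comp_const_add_smul_le {F : E → ℝ≥0∞} (hF : Measurable F) (c : E) {t : ℝ}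
    (ht : 1 / 2 ≤ t) :
    ∫⁻ y, F (c + t • y) ∂μ ≤ 2 ^ Module.finrank ℝ E * ∫⁻ y, F y ∂μ := by
  have ht0 : 0 < t := by linarith
  rw [lintegral_comp_const_add_smul μ hF c ht0.ne']
  gcongr
  rw [abs_of_pos (by positivity), ← inv_pow, ENNReal.ofReal_pow (by positivity)]
  gcongr
  rw [← ENNReal.ofReal_ofNat]
  apply ENNReal.ofReal_le_ofReal
  rw [inv_le_comm₀ ht0 (by norm_num)]
  linarith

/-- For `t ≥ 1/2` the substitution in `y` has Jacobian `t⁻ᵈ ≤ 2ᵈ`, with `d` the dimension; for `t ≤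
1/2` exchange `x` and `y`. Taking the better variable avoids the singularities at both ends. -/
theorem setLIntegral_setLIntegral_segment_le {F : E → ℝ≥0∞} (hF : Measurable F) (B : Set E)
    {t : ℝ} :
    ∫⁻ x in B, ∫⁻ y in B, F ((1 - t) • x + t • y) ∂μ ∂μ
      ≤ 2 ^ Module.finrank ℝ E * μ B * ∫⁻ y, F y ∂μ := by
  have aux : ∀ {s : ℝ}, 1 / 2 ≤ s →
      ∫⁻ x in B, ∫⁻ y in B, F ((1 - s) • x + s • y) ∂μ ∂μ
        ≤ 2 ^ Module.finrank ℝ E * μ B * ∫⁻ y, F y ∂μ := by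
    intro s hs
    calc _ ≤ ∫⁻ _ in B, 2 ^ Module.finrank ℝ E * ∫⁻ y, F y ∂μ ∂μ :=
          lintegral_mono fun x => (setLIntegral_le_lintegral _ _).trans
            (lintegral_comp_const_add_smul_le μ hF _ hs)
      _ = _ := by rw [setLIntegral_const]; ring
  rcases le_total (1 / 2) t with ht | ht
  · exact aux ht
  · rw [lintegral_lintegral_swap]
    · have := aux (s := 1 - t) (by linarith)
      simpa only [sub_sub_cancel, add_comm] using this
    · refine Measurable.aemeasurable ?_
      exact hF.comp ((measurable_fst.const_smul _).add (measurable_snd.const_smul _))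

end SegmentAverage

theorem sq_intervalIntegral_le {h : ℝ → ℝ} (hh : Continuous h) :
    (∫ t in (0 : ℝ)..1, h t) ^ 2 ≤ ∫ t in (0 : ℝ)..1, h t ^ 2 := by
  set m := ∫ t in (0 : ℝ)..1, h t with hm
  have h0 : 0 ≤ ∫ t in (0 : ℝ)..1, (h t - m) ^ 2 :=
    intervalIntegral.integral_nonneg zero_le_one fun t _ => sq_nonneg _
  have h1 : ∫ t in (0 : ℝ)..1, (h t - m) ^ 2
      = (∫ t in (0 : ℝ)..1, h t ^ 2) - m ^ 2 := by
    have e : ∀ t, (h t - m) ^ 2 = h t ^ 2 - 2 * m * h t + m ^ 2 := fun t => by ring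
    simp only [e]
    have i1 : IntervalIntegrable (fun t => h t ^ 2) volume 0 1 :=
      (hh.pow 2).intervalIntegrable _ _
    have i2 : IntervalIntegrable (fun t => 2 * m * h t) volume 0 1 :=
      (continuous_const.mul hh).intervalIntegrable _ _
    rw [intervalIntegral.integral_add (i1.sub i2) (by simp),
      intervalIntegral.integral_sub i1 i2, intervalIntegral.integral_const_mul, ← hm]
    simp; ring
  linarith

theorem sq_clm_apply_le (L : EuclideanSpace ℝ (Fin n) →L[ℝ] ℝ) (v : EuclideanSpace ℝ (Fin n)) :
    (L v) ^ 2 ≤ ‖v‖ ^ 2 * ∑ i, L (EuclideanSpace.single i 1) ^ 2 := by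
  have hv : L v = ∑ i, v i * L (EuclideanSpace.single i 1) := by
    conv_lhs => rw [← (EuclideanSpace.basisFun (Fin n) ℝ).sum_repr v]
    simp
  rw [hv, EuclideanSpace.real_norm_sq_eq]
  exact Finset.sum_mul_sq_le_sq_mul_sq _ _ _

theorem sq_sub_le_integral_segment {u : EuclideanSpace ℝ (Fin n) → ℝ} (hu : ContDiff ℝ 1 u)
    (x y : EuclideanSpace ℝ (Fin n)) :
    (u x - u y) ^ 2 ≤ ∫ t in (0 : ℝ)..1, ‖y - x‖ ^ 2 *
      ∑ i, fderiv ℝ u ((1 - t) • x + t • y) (EuclideanSpace.single i 1) ^ 2 := by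
  have hz : Continuous fun t : ℝ => (1 - t) • x + t • y := by fun_prop
  have hfd : ∀ v, Continuous fun t : ℝ => fderiv ℝ u ((1 - t) • x + t • y) v := fun v =>
    ((hu.continuous_fderiv one_ne_zero).comp hz).clm_apply continuous_const
  have hd : ∀ t : ℝ, HasDerivAt (fun t : ℝ => u ((1 - t) • x + t • y))
      (fderiv ℝ u ((1 - t) • x + t • y) (y - x)) t := by
    intro t
    have h1 : HasDerivAt (fun t : ℝ => (1 - t) • x + t • y) (y - x) t := by
      have := (((hasDerivAt_id t).const_sub 1).smul_const x).add
        ((hasDerivAt_id t).smul_const y)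
      convert! this using 1
      simp; abel
    exact (hu.differentiable one_ne_zero _).hasFDerivAt.comp_hasDerivAt t h1
  have hftc := intervalIntegral.integral_eq_sub_of_hasDerivAt (a := 0) (b := 1)
    (fun t _ => hd t) ((hfd _).intervalIntegrable _ _)
  simp only [sub_self, zero_smul, one_smul, zero_add, sub_zero, add_zero] at hftc
  calc (u x - u y) ^ 2 = (∫ t in (0 : ℝ)..1, fderiv ℝ u ((1 - t) • x + t • y) (y - x)) ^ 2 := by
        rw [hftc]; ring
    _ ≤ ∫ t in (0 : ℝ)..1, (fderiv ℝ u ((1 - t) • x + t • y) (y - x)) ^ 2 :=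
        sq_intervalIntegral_le (hfd _)
    _ ≤ _ := by
        refine intervalIntegral.integral_mono_on zero_le_one
          (((hfd _).pow 2).intervalIntegrable _ _) (Continuous.intervalIntegrable ?_ _ _)
          fun t _ => sq_clm_apply_le _ _
        exact continuous_const.mul (continuous_finsetSum _ fun i _ => (hfd _).pow 2)

theorem integral_sub_const_sq {α : Type*} [MeasurableSpace α] {μ : Measure α} [IsFiniteMeasure μ]
    {f : α → ℝ} (hf : Integrable f μ) (hf2 : Integrable (fun x => f x * f x) μ) (c : ℝ) :
    ∫ x, (f x - c) ^ 2 ∂μ = (∫ x, f x * f x ∂μ) - 2 * c * ∫ x, f x ∂μ + c ^ 2 * μ.real Set.univ := by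
  have e : ∀ x, (f x - c) ^ 2 = (f x * f x - 2 * c * f x) + c ^ 2 := fun x => by ring
  have h1 : Integrable (fun x => 2 * c * f x) μ := hf.const_mul _
  have h2 : Integrable (fun x => f x * f x - 2 * c * f x) μ := hf2.sub h1
  simp only [e]
  rw [integral_add h2 (integrable_const _), integral_sub hf2 h1, integral_const_mul,
    integral_const, smul_eq_mul]
  ring

theorem ofReal_sq_sub_le_lintegral_segment {u : EuclideanSpace ℝ (Fin n) → ℝ}
    (hu : ContDiff ℝ 1 u) {R : ℝ} {x y : EuclideanSpace ℝ (Fin n)}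
    (hx : x ∈ Metric.closedBall 0 R) (hy : y ∈ Metric.closedBall 0 R) :
    ENNReal.ofReal ((u x - u y) ^ 2) ≤ ∫⁻ t in Set.Ioc (0 : ℝ) 1, ENNReal.ofReal (4 * R ^ 2) *
      (Metric.closedBall 0 R).indicator (fun z => ENNReal.ofReal
        (∑ i, fderiv ℝ u z (EuclideanSpace.single i 1) ^ 2)) ((1 - t) • x + t • y) := by
  set G : EuclideanSpace ℝ (Fin n) → ℝ :=
    fun z => ∑ i, fderiv ℝ u z (EuclideanSpace.single i 1) ^ 2 with hG
  have hfd : ∀ v, Continuous fun z => fderiv ℝ u z v := fun v =>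
    (hu.continuous_fderiv one_ne_zero).clm_apply continuous_const
  have hGc : Continuous G := continuous_finsetSum _ fun i _ => (hfd _).pow 2
  have hG0 : ∀ z, 0 ≤ G z := fun z => Finset.sum_nonneg fun i _ => sq_nonneg _
  have hxR : ‖x‖ ≤ R := by simpa using hx
  have hyR : ‖y‖ ≤ R := by simpa using hy
  have hcont : Continuous fun t : ℝ => ‖y - x‖ ^ 2 * G ((1 - t) • x + t • y) :=
    continuous_const.mul (hGc.comp (by fun_prop))
  refine (ENNReal.ofReal_le_ofReal (sq_sub_le_integral_segment hu x y)).trans ?_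
  rw [intervalIntegral.integral_of_le zero_le_one, ofReal_integral_eq_lintegral_ofReal
    ((hcont.intervalIntegrable 0 1).1) (Eventually.of_forall fun t =>
      mul_nonneg (sq_nonneg _) (hG0 _))]
  refine setLIntegral_mono' measurableSet_Ioc fun t ht => ?_
  have hz : (1 - t) • x + t • y ∈ Metric.closedBall (0 : EuclideanSpace ℝ (Fin n)) R :=
    (convex_closedBall _ _) hx hy (by linarith [ht.2]) ht.1.le (by ring)
  -- By convexity the indicator costs nothing here; it keeps the final bound on the ball although
  -- the substitution runs over the whole space.
  rw [Set.indicator_of_mem hz, ← ENNReal.ofReal_mul (by positivity)]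
  refine ENNReal.ofReal_le_ofReal (mul_le_mul_of_nonneg_right ?_ (hG0 _))
  have h2 : ‖y - x‖ ≤ 2 * R := (norm_sub_le _ _).trans (by linarith)
  nlinarith [norm_nonneg (y - x)]

theorem setLIntegral_average_segment_le {F : EuclideanSpace ℝ (Fin n) → ℝ≥0∞}
    (hF : Measurable F) (B : Set (EuclideanSpace ℝ (Fin n))) :
    ∫⁻ x in B, ∫⁻ y in B, ∫⁻ t in Set.Ioc (0 : ℝ) 1, F ((1 - t) • x + t • y)
      ≤ 2 ^ n * volume B * ∫⁻ z, F z := by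
  calc _ = ∫⁻ x in B, ∫⁻ t in Set.Ioc (0 : ℝ) 1, ∫⁻ y in B, F ((1 - t) • x + t • y) := by
        refine lintegral_congr fun x => lintegral_lintegral_swap (Measurable.aemeasurable ?_)
        exact hF.comp (by fun_prop : Measurable
          fun p : EuclideanSpace ℝ (Fin n) × ℝ => (1 - p.2) • x + p.2 • p.1)
    _ = ∫⁻ t in Set.Ioc (0 : ℝ) 1, ∫⁻ x in B, ∫⁻ y in B, F ((1 - t) • x + t • y) := by
        refine lintegral_lintegral_swap (Measurable.aemeasurable ?_)
        exact Measurable.lintegral_prod_right' (f := fun q :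
          (EuclideanSpace ℝ (Fin n) × ℝ) × EuclideanSpace ℝ (Fin n) =>
            F ((1 - q.1.2) • q.1.1 + q.1.2 • q.2)) (hF.comp (by fun_prop : Measurable fun q :
          (EuclideanSpace ℝ (Fin n) × ℝ) × EuclideanSpace ℝ (Fin n) =>
            (1 - q.1.2) • q.1.1 + q.1.2 • q.2))
    _ ≤ ∫⁻ _ in Set.Ioc (0 : ℝ) 1, 2 ^ n * volume B * ∫⁻ z, F z := by
        refine lintegral_mono fun t => ?_
        simpa using setLIntegral_setLIntegral_segment_le volume hF B (t := t)
    _ = _ := by simp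

theorem lintegral_sq_sub_le {u : EuclideanSpace ℝ (Fin n) → ℝ} (hu : ContDiff ℝ 1 u) (R : ℝ) :
    ∫⁻ x in Metric.closedBall 0 R, ∫⁻ y in Metric.closedBall 0 R,
        ENNReal.ofReal ((u x - u y) ^ 2)
      ≤ ENNReal.ofReal (4 * R ^ 2) *
        (2 ^ n * volume (Metric.closedBall (0 : EuclideanSpace ℝ (Fin n)) R) *
          ∫⁻ z in Metric.closedBall 0 R, ENNReal.ofReal
            (∑ i, fderiv ℝ u z (EuclideanSpace.single i 1) ^ 2)) := by
  have hBm : MeasurableSet (Metric.closedBall (0 : EuclideanSpace ℝ (Fin n)) R) :=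
    Metric.isClosed_closedBall.measurableSet
  have hfd : ∀ v, Continuous fun z => fderiv ℝ u z v := fun v =>
    (hu.continuous_fderiv one_ne_zero).clm_apply continuous_const
  have hGm : Measurable fun z => ENNReal.ofReal
      (∑ i, fderiv ℝ u z (EuclideanSpace.single i 1) ^ 2) :=
    (continuous_finsetSum _ fun i _ => (hfd _).pow 2).measurable.ennreal_ofReal
  have h := setLIntegral_average_segment_le (hGm.indicator hBm) (Metric.closedBall 0 R)
  rw [lintegral_indicator hBm] at h
  refine le_trans ?_ (mul_le_mul_right h (ENNReal.ofReal (4 * R ^ 2)))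
  simp only [← lintegral_const_mul' _ _ ENNReal.ofReal_ne_top]
  exact setLIntegral_mono' hBm fun x hx => setLIntegral_mono' hBm fun y hy =>
    ofReal_sq_sub_le_lintegral_segment hu hx hy

/-- Expanding the square turns the double integral into twice a variance, written without division.
-/
theorem lintegral_sq_sub_eq {u : EuclideanSpace ℝ (Fin n) → ℝ} (hu : Continuous u) {R : ℝ} :
    ∫⁻ x in Metric.closedBall 0 R, ∫⁻ y in Metric.closedBall 0 R,
        ENNReal.ofReal ((u x - u y) ^ 2)
      = ENNReal.ofReal (2 * (volume.real (Metric.closedBall (0 : EuclideanSpace ℝ (Fin n)) R) *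
        (∫ x in Metric.closedBall 0 R, u x * u x) - (∫ x in Metric.closedBall 0 R, u x) ^ 2)) := by
  set B := Metric.closedBall (0 : EuclideanSpace ℝ (Fin n)) R with hB
  have hBc : IsCompact B := isCompact_closedBall _ _
  have hfin : IsFiniteMeasure (volume.restrict B) := ⟨by simpa using hBc.measure_lt_top⟩
  have hci : ∀ {v : EuclideanSpace ℝ (Fin n) → ℝ}, Continuous v → IntegrableOn v B := fun hv =>
    hv.continuousOn.integrableOn_compact hBc
  set v := volume.real B with hv
  set S := ∫ x in B, u x with hS
  set Q := ∫ x in B, u x * u x with hQ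
  have hinner : ∀ x, ∫ y in B, (u x - u y) ^ 2 = Q - 2 * u x * S + (u x) ^ 2 * v := by
    intro x
    simp only [fun y => show (u x - u y) ^ 2 = (u y - u x) ^ 2 by ring]
    rw [integral_sub_const_sq (hci hu) (hci (hu.mul hu))]
    simp [hv]
    rfl
  have hinner' : ∀ x, ∫⁻ y in B, ENNReal.ofReal ((u x - u y) ^ 2)
      = ENNReal.ofReal (Q - 2 * u x * S + (u x) ^ 2 * v) := by
    intro x
    have hi : IntegrableOn (fun y => (u x - u y) ^ 2) B := hci (by fun_prop)
    rw [← hinner, ofReal_integral_eq_lintegral_ofReal hi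
      (Eventually.of_forall fun y => sq_nonneg _)]
  simp only [hinner']
  have i1 : IntegrableOn (fun x => 2 * S * u x) B := hci (continuous_const.mul hu)
  have i2 : IntegrableOn (fun x => v * (u x * u x)) B := hci (continuous_const.mul (hu.mul hu))
  have i3 : IntegrableOn (fun x => Q - 2 * S * u x) B := hci (by fun_prop)
  have i4 : IntegrableOn (fun _ => Q) B := hci (by fun_prop)
  have i5 : IntegrableOn (fun x => Q - 2 * u x * S + (u x) ^ 2 * v) B := hci (by fun_prop)
  rw [← ofReal_integral_eq_lintegral_ofReal i5 (Eventually.of_forall fun x => ?_)]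
  · congr 1
    simp only [fun x => show Q - 2 * u x * S + (u x) ^ 2 * v
      = (Q - 2 * S * u x) + v * (u x * u x) by ring]
    rw [integral_add i3 i2, integral_sub i4 i1, integral_const_mul, integral_const_mul,
      setIntegral_const, smul_eq_mul]
    ring
  · simp only [Pi.zero_apply, ← hinner]
    exact integral_nonneg fun y => sq_nonneg _

/-- The constant is `4R² · 2ⁿ` halved: squared diameter times Jacobian bound, over the factor `2` in
the variance identity. -/
theorem variance_closedBall_le_of_contDiff {u : EuclideanSpace ℝ (Fin n) → ℝ}
    (hu : ContDiff ℝ 1 u) (R : ℝ) :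
    volume.real (Metric.closedBall (0 : EuclideanSpace ℝ (Fin n)) R) *
        (∫ x in Metric.closedBall 0 R, u x * u x) - (∫ x in Metric.closedBall 0 R, u x) ^ 2
      ≤ 2 ^ (n + 1) * R ^ 2 * volume.real (Metric.closedBall (0 : EuclideanSpace ℝ (Fin n)) R) *
        ∑ i, ∫ x in Metric.closedBall 0 R, fderiv ℝ u x (EuclideanSpace.single i 1) *
          fderiv ℝ u x (EuclideanSpace.single i 1) := by
  have hmain := lintegral_sq_sub_le hu R
  rw [lintegral_sq_sub_eq hu.continuous] at hmain
  set B := Metric.closedBall (0 : EuclideanSpace ℝ (Fin n)) R with hB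
  have hBc : IsCompact B := isCompact_closedBall _ _
  have hfd : ∀ v, Continuous fun z => fderiv ℝ u z v := fun v =>
    (hu.continuous_fderiv one_ne_zero).clm_apply continuous_const
  have hci : ∀ {v : EuclideanSpace ℝ (Fin n) → ℝ}, Continuous v → IntegrableOn v B := fun hv =>
    hv.continuousOn.integrableOn_compact hBc
  have hG0 : ∀ z, 0 ≤ ∑ i, fderiv ℝ u z (EuclideanSpace.single i 1) ^ 2 :=
    fun z => Finset.sum_nonneg fun i _ => sq_nonneg _
  have hGint : ∫ z in B, ∑ i, fderiv ℝ u z (EuclideanSpace.single i 1) ^ 2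
      = ∑ i, ∫ x in B, fderiv ℝ u x (EuclideanSpace.single i 1) *
      fderiv ℝ u x (EuclideanSpace.single i 1) := by
    simp only [pow_two]
    exact integral_finsetSum _ fun i _ => hci ((hfd _).mul (hfd _))
  have hI0 : 0 ≤ ∫ z in B, ∑ i, fderiv ℝ u z (EuclideanSpace.single i 1) ^ 2 :=
    integral_nonneg hG0
  have hGi : IntegrableOn (fun z => ∑ i, fderiv ℝ u z (EuclideanSpace.single i 1) ^ 2) B :=
    hci (continuous_finsetSum _ fun i _ => (hfd _).pow 2)
  rw [← ofReal_integral_eq_lintegral_ofReal hGi (Eventually.of_forall hG0)] at hmain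
  rw [← hGint]
  have hvB : volume B = ENNReal.ofReal (volume.real B) :=
    (ENNReal.ofReal_toReal hBc.measure_lt_top.ne).symm
  have h2n : (2 : ℝ≥0∞) ^ n = ENNReal.ofReal (2 ^ n) := by
    rw [ENNReal.ofReal_pow zero_le_two, ENNReal.ofReal_ofNat]
  rw [hvB, h2n, ← ENNReal.ofReal_mul (by positivity), ← ENNReal.ofReal_mul (by positivity),
    ← ENNReal.ofReal_mul (by positivity), ENNReal.ofReal_le_ofReal_iff (by positivity)] at hmain
  rw [pow_succ (2 : ℝ) n]
  linarith

/-- Poincaré inequality for weakly differentiable functions on a ball. -/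
theorem IsWeakGradient.poincare_closedBall {f : EuclideanSpace ℝ (Fin n) → ℝ}
    {g : EuclideanSpace ℝ (Fin n) → EuclideanSpace ℝ (Fin n)} (h : IsWeakGradient f g)
    (hf : ∀ r : ℝ, MemLp f 2 (volume.restrict (Metric.closedBall 0 r)))
    (hg : ∀ r : ℝ, MemLp g 2 (volume.restrict (Metric.closedBall 0 r))) {R : ℝ} (hR : 0 < R) :
    ∃ c : ℝ, ∫ x in Metric.closedBall 0 R, (f x - c) ^ 2
      ≤ 2 ^ (n + 1) * R ^ 2 * ∫ x in Metric.closedBall 0 R, ‖g x‖ ^ 2 := by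
  obtain ⟨u, hu, hlim⟩ := h.exists_smooth_approx hf hg
  set B := Metric.closedBall (0 : EuclideanSpace ℝ (Fin n)) R with hB
  have hBc : IsCompact B := isCompact_closedBall _ _
  have hfin : IsFiniteMeasure (volume.restrict B) := ⟨by simpa using hBc.measure_lt_top⟩
  have hu1 : ∀ k, ContDiff ℝ 1 (u k) := fun k => (hu k).of_le (by exact_mod_cast le_top)
  have huL : ∀ k, MemLp (u k) 2 (volume.restrict B) := fun k =>
    (hu k).continuous.memLp_restrict_closedBall R
  have hduL : ∀ i k, MemLp (fun x => fderiv ℝ (u k) x (EuclideanSpace.single i 1)) 2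
      (volume.restrict B) := fun i k => Continuous.memLp_restrict_closedBall
      (((hu1 k).continuous_fderiv one_ne_zero).clm_apply continuous_const) R
  set v := volume.real B with hv
  have hv0 : 0 < v := ENNReal.toReal_pos
    (Metric.measure_closedBall_pos volume 0 hR).ne' hBc.measure_lt_top.ne
  have t1 := tendsto_integral_mul_of_tendsto_eLpNorm (l := atTop) huL huL (hf R) (hf R)
    (hlim R).1 (hlim R).1
  have t2 := tendsto_integral_mul_of_tendsto_eLpNorm (l := atTop) (b := fun _ _ => 1)
    (b₀ := fun _ => 1) huL (fun _ => memLp_const 1) (hf R) (memLp_const 1) (hlim R).1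
    (by simp)
  have t3 : ∀ i, _ := fun i => tendsto_integral_mul_of_tendsto_eLpNorm (l := atTop) (hduL i)
    (hduL i) (memLp_apply (hg R) i) (memLp_apply (hg R) i) ((hlim R).2 i) ((hlim R).2 i)
  simp only [mul_one] at t2
  have hle := le_of_tendsto_of_tendsto' ((t1.const_mul v).sub (t2.pow 2))
    ((tendsto_finsetSum Finset.univ fun i _ => t3 i).const_mul (2 ^ (n + 1) * R ^ 2 * v))
    fun k => variance_closedBall_le_of_contDiff (hu1 k) R
  have hgsum : ∑ i, ∫ x in B, g x i * g x i = ∫ x in B, ‖g x‖ ^ 2 := by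
    have hi : ∀ i, IntegrableOn (fun x => g x i * g x i) B := fun i =>
      (memLp_apply (hg R) i).integrable_mul (memLp_apply (hg R) i)
    rw [← integral_finsetSum _ fun i _ => hi i]
    simp only [EuclideanSpace.real_norm_sq_eq]
    simp only [pow_two]
  rw [hgsum] at hle
  set S := ∫ x in B, f x with hS
  -- The witness is the Lebesgue mean of `f` over the ball.
  refine ⟨S / v, ?_⟩
  have hf1 : Integrable f (volume.restrict B) := (hf R).integrable (by norm_num)
  have hf2 : Integrable (fun x => f x * f x) (volume.restrict B) := (hf R).integrable_mul (hf R)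
  have hvar : ∫ x in B, (f x - S / v) ^ 2 = (∫ x in B, f x * f x) - S ^ 2 / v := by
    rw [integral_sub_const_sq hf1 hf2, ← hS, measureReal_restrict_apply_univ, ← hv]
    field_simp
    ring
  rw [hvar]
  refine le_of_mul_le_mul_left (le_trans (le_of_eq ?_) (hle.trans (le_of_eq ?_))) hv0
  · field_simp
  · ring


/-! ### Cutoff functions and differential calculus for `exp (-V)`. -/

theorem exists_cutoff (n : ℕ) : ∃ (χ : ℕ → EuclideanSpace ℝ (Fin n) → ℝ) (c : ℝ),
    (∀ k, ContDiff ℝ ∞ (χ k)) ∧ (∀ k, HasCompactSupport (χ k)) ∧ (∀ k x, 0 ≤ χ k x) ∧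
      (∀ k x, χ k x ≤ 1) ∧ (∀ x, ∀ᶠ k in atTop, χ k x = 1) ∧
      ∀ k x i, |fderiv ℝ (χ k) x (EuclideanSpace.single i 1)| ≤ c * (1 / ((k : ℝ) + 1)) := by
  let b : ContDiffBump (0 : EuclideanSpace ℝ (Fin n)) := ⟨1, 2, one_pos, one_lt_two⟩
  have hb1 : ContDiff ℝ 1 b := b.contDiff
  obtain ⟨c, hc⟩ := (b.hasCompactSupport.fderiv ℝ).exists_bound_of_continuous
    (hb1.continuous_fderiv one_ne_zero)
  have hs0 : ∀ k : ℕ, (1 / ((k : ℝ) + 1)) ≠ 0 := fun k => by positivity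
  refine ⟨fun k x => b ((1 / ((k : ℝ) + 1)) • x), c, fun k => b.contDiff.comp
    (contDiff_const_smul _), fun k => b.hasCompactSupport.comp_smul (hs0 k),
    fun k x => b.nonneg, fun k x => b.le_one, fun x => ?_, fun k x i => ?_⟩
  · filter_upwards [eventually_ge_atTop ⌈‖x‖⌉₊] with k hk
    apply b.one_of_mem_closedBall
    have h1 : ‖x‖ ≤ k := (Nat.le_ceil _).trans (by exact_mod_cast hk)
    have h2 : (0 : ℝ) < (k : ℝ) + 1 := by positivity
    rw [mem_closedBall_zero_iff, norm_smul, Real.norm_of_nonneg (by positivity)]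
    change 1 / ((k : ℝ) + 1) * ‖x‖ ≤ 1
    rw [one_div, inv_mul_le_iff₀ h2]
    linarith
  · change |fderiv ℝ (fun x => b ((1 / ((k : ℝ) + 1)) • x)) x _| ≤ _
    rw [fderiv_comp_smul, smul_apply, smul_eq_mul, abs_mul, mul_comm]
    have h3 := (fderiv ℝ b ((1 / ((k : ℝ) + 1)) • x)).le_opNorm (EuclideanSpace.single i 1)
    rw [PiLp.norm_single, norm_one, mul_one] at h3
    rw [abs_of_nonneg (by positivity : (0 : ℝ) ≤ 1 / ((k : ℝ) + 1))]
    gcongr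
    exact h3.trans (hc _)

section Calculus

variable {V : EuclideanSpace ℝ (Fin n) → ℝ}

theorem gradient_apply (V : EuclideanSpace ℝ (Fin n) → ℝ) (x : EuclideanSpace ℝ (Fin n))
    (i : Fin n) : gradient V x i = fderiv ℝ V x (EuclideanSpace.single i 1) := by
  have h : inner ℝ (gradient V x) (EuclideanSpace.single i (1 : ℝ))
      = fderiv ℝ V x (EuclideanSpace.single i 1) := by
    rw [gradient, InnerProductSpace.toDual_symm_apply]
  rw [← h, EuclideanSpace.inner_single_right]
  simp

theorem norm_gradient_sq (V : EuclideanSpace ℝ (Fin n) → ℝ) (x : EuclideanSpace ℝ (Fin n)) :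
    ‖gradient V x‖ ^ 2 = ∑ i, fderiv ℝ V x (EuclideanSpace.single i 1) ^ 2 := by
  rw [EuclideanSpace.real_norm_sq_eq]
  simp only [gradient_apply]

theorem contDiff_fderiv_apply (hV : ContDiff ℝ 2 V) (e : EuclideanSpace ℝ (Fin n)) :
    ContDiff ℝ 1 fun y => fderiv ℝ V y e :=
  (hV.fderiv_right (m := 1) (by norm_num)).clm_apply contDiff_const

theorem laplacian_eq_sum_fderiv (hV : ContDiff ℝ 2 V) (x : EuclideanSpace ℝ (Fin n)) :
    Laplacian.laplacian V x = ∑ i, fderiv ℝ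
      (fun y => fderiv ℝ V y (EuclideanSpace.single i 1)) x (EuclideanSpace.single i 1) := by
  rw [InnerProductSpace.laplacian_eq_iteratedFDeriv_orthonormalBasis V
    (EuclideanSpace.basisFun (Fin n) ℝ)]
  refine Finset.sum_congr rfl fun i _ => ?_
  have hd : DifferentiableAt ℝ (fderiv ℝ V) x :=
    (hV.fderiv_right (m := 1) (by norm_num)).differentiable one_ne_zero x
  rw [iteratedFDeriv_two_apply, fderiv_clm_apply hd (differentiableAt_const _)]
  simp

theorem continuous_fderiv_fderiv_apply (hV : ContDiff ℝ 2 V) (e : EuclideanSpace ℝ (Fin n)) :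
    Continuous fun x => fderiv ℝ (fun y => fderiv ℝ V y e) x e :=
  ((contDiff_fderiv_apply hV e).continuous_fderiv one_ne_zero).clm_apply continuous_const

theorem continuous_norm_gradient_sq (hV : ContDiff ℝ 2 V) :
    Continuous fun x => ‖gradient V x‖ ^ 2 := by
  simp only [norm_gradient_sq]
  exact continuous_finsetSum _ fun i _ => (contDiff_fderiv_apply hV _).continuous.pow 2

theorem continuous_laplacian (hV : ContDiff ℝ 2 V) :
    Continuous fun x => Laplacian.laplacian V x := by
  simp only [laplacian_eq_sum_fderiv hV]
  exact continuous_finsetSum _ fun i _ => continuous_fderiv_fderiv_apply hV _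

/-- For `χ = 1` and `e` running over the standard basis, the sum is `-ΔM`; the term with `fderiv ℝ
χ` is the cutoff error. -/
theorem fderiv_sq_mul_fderiv_mul_exp (hV : ContDiff ℝ 2 V) {χ : EuclideanSpace ℝ (Fin n) → ℝ}
    (hχ : ContDiff ℝ 1 χ) (e x : EuclideanSpace ℝ (Fin n)) :
    fderiv ℝ (fun y => χ y ^ 2 * (fderiv ℝ V y e * Real.exp (-V y))) x e
      = (χ x ^ 2 * (fderiv ℝ (fun y => fderiv ℝ V y e) x e - fderiv ℝ V x e ^ 2)
        + 2 * χ x * fderiv ℝ χ x e * fderiv ℝ V x e) * Real.exp (-V x) := by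
  have h1 := (hχ.differentiable one_ne_zero x).hasFDerivAt
  have h2 := ((contDiff_fderiv_apply hV e).differentiable one_ne_zero x).hasFDerivAt
  have h3 := (hV.differentiable two_ne_zero x).hasFDerivAt
  have h := (h1.pow 2).mul (h2.mul h3.neg.exp)
  refine (congrArg (fun L => L e) h.fderiv).trans ?_
  simp
  ring

end Calculus

/-! ### Weighted versus local Lebesgue integrability; stability and uniqueness of weak gradients. -/

theorem memLp_restrict_closedBall_of_integrable {F : Type*} [NormedAddCommGroup F]
    {u : EuclideanSpace ℝ (Fin n) → F} (hu : LocallyIntegrable u volume)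
    {M : EuclideanSpace ℝ (Fin n) → ℝ} (hM : Continuous M) (hM0 : ∀ x, 0 < M x)
    (huM : Integrable (fun x => ‖u x‖ ^ 2 * M x) volume) (r : ℝ) :
    MemLp u 2 (volume.restrict (Metric.closedBall 0 r)) := by
  rw [← memLp_norm_iff hu.aestronglyMeasurable.restrict,
    memLp_two_iff_integrable_sq hu.aestronglyMeasurable.restrict.norm]
  have h : IntegrableOn (fun x => (‖u x‖ ^ 2 * M x) * (M x)⁻¹) (Metric.closedBall 0 r) volume :=
    huM.integrableOn.mul_continuousOn (hM.inv₀ fun x => (hM0 x).ne').continuousOn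
      (isCompact_closedBall _ _)
  refine h.congr (Eventually.of_forall fun x => ?_)
  simp only
  rw [mul_assoc, mul_inv_cancel₀ (hM0 x).ne', mul_one]

theorem integrable_sq_mul_of_memLp {F : Type*} [NormedAddCommGroup F]
    {u : EuclideanSpace ℝ (Fin n) → F} {M : EuclideanSpace ℝ (Fin n) → ℝ} (hM : Continuous M)
    (hM0 : ∀ x, 0 < M x) (hu : MemLp u 2 (weightedMeasure M)) :
    Integrable (fun x => ‖u x‖ ^ 2 * M x) volume := by
  have h := hu.integrable_norm_pow (by norm_num)
  rw [weightedMeasure, integrable_withDensity_iff_integrable_smul' hM.measurable.ennreal_ofReal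
    (Eventually.of_forall fun _ => ENNReal.ofReal_lt_top)] at h
  refine h.congr (Eventually.of_forall fun x => ?_)
  simp [ENNReal.toReal_ofReal (hM0 x).le, mul_comm]

theorem IsWeakGradient.sub_const {f : EuclideanSpace ℝ (Fin n) → ℝ}
    {g : EuclideanSpace ℝ (Fin n) → EuclideanSpace ℝ (Fin n)} (h : IsWeakGradient f g) (c : ℝ) :
    IsWeakGradient (fun x => f x - c) g := by
  refine ⟨h.1.sub (locallyIntegrable_const c), h.2.1, fun φ hφ hφc i => ?_⟩
  have hφ1 : ContDiff ℝ 1 φ := hφ.of_le (by exact_mod_cast le_top)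
  have hφ' : Continuous fun x => fderiv ℝ φ x (EuclideanSpace.single i 1) :=
    (hφ1.continuous_fderiv one_ne_zero).clm_apply continuous_const
  have hφ'c : HasCompactSupport fun x => fderiv ℝ φ x (EuclideanSpace.single i 1) :=
    hφc.fderiv_apply ℝ _
  have h0 := integral_mul_fderiv_eq_neg_fderiv_mul_of_integrable (μ := volume)
    (f := fun _ => c) (g := φ) (v := EuclideanSpace.single i 1) (by simp)
    ((continuous_const.mul hφ').integrable_of_hasCompactSupport hφ'c.mul_left)
    ((continuous_const.mul hφ1.continuous).integrable_of_hasCompactSupport hφc.mul_left)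
    (fun x _ => differentiableAt_const _) (fun x _ => hφ1.differentiable one_ne_zero x)
  have hi1 : Integrable (fun x => f x * fderiv ℝ φ x (EuclideanSpace.single i 1)) := by
    simpa [mul_comm] using h.1.integrable_smul_left_of_hasCompactSupport hφ' hφ'c
  have hi2 : Integrable (fun x => c * fderiv ℝ φ x (EuclideanSpace.single i 1)) :=
    (continuous_const.mul hφ').integrable_of_hasCompactSupport hφ'c.mul_left
  simp only [sub_mul]
  rw [integral_sub hi1 hi2, h0, h.2.2 φ hφ hφc i]
  simp

/-- Lets weighted square integrability of one weak gradient pass to any other. -/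
theorem IsWeakGradient.ae_unique {f : EuclideanSpace ℝ (Fin n) → ℝ}
    {g g' : EuclideanSpace ℝ (Fin n) → EuclideanSpace ℝ (Fin n)} (h : IsWeakGradient f g)
    (h' : IsWeakGradient f g') : g =ᵐ[volume] g' := by
  have hloc : ∀ {g : EuclideanSpace ℝ (Fin n) → EuclideanSpace ℝ (Fin n)},
      LocallyIntegrable g volume → ∀ i, LocallyIntegrable (fun x => g x i) volume := fun hg i =>
    locallyIntegrable_iff.mpr fun k hk =>
      (EuclideanSpace.proj (𝕜 := ℝ) i).integrable_comp (hg.integrableOn_isCompact hk)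
  have hi : ∀ i, ∀ᵐ x, g x i = g' x i := fun i =>
    ae_eq_of_integral_contDiff_smul_eq (hloc h.2.1 i) (hloc h'.2.1 i) fun φ hφ hφc => by
      have e := (h.2.2 φ hφ hφc i).symm.trans (h'.2.2 φ hφ hφc i)
      simpa [mul_comm] using e
  filter_upwards [ae_all_iff.mpr hi] with x hx
  ext i
  exact hx i


/-! ### The weighted energy estimate. -/

section Energy

variable {V f : EuclideanSpace ℝ (Fin n) → ℝ}
  {g : EuclideanSpace ℝ (Fin n) → EuclideanSpace ℝ (Fin n)}

/-- The `q` terms cancel and `p²` keeps the coefficient `-a F²χ²`. The cross terms are `2(Fχp)(Fχ' +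
χG) ≤ (Fχp)²/2 + 4(Fχ')² + 4(χG)²`, so `a ≥ 1/2` suffices. -/
theorem energy_pointwise_le {a χ χ' p q F G m c : ℝ} (ha : 1 / 2 ≤ a) (hχ0 : 0 ≤ χ)
    (hχ1 : χ ≤ 1) (hc : |χ'| ≤ c) (hm : 0 ≤ m) :
    F ^ 2 * (χ ^ 2 * ((1 - a) * p ^ 2 - q)) * m
        + (F * (F * ((χ ^ 2 * (q - p ^ 2) + 2 * χ * χ' * p) * m))
          + 2 * (F * (G * (χ ^ 2 * (p * m)))))
      ≤ 4 * (G ^ 2 * m) + 4 * c ^ 2 * (F ^ 2 * m) := by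
  have h1 : χ' ^ 2 ≤ c ^ 2 := sq_le_sq' (abs_le.mp hc).1 (abs_le.mp hc).2
  have h2 : χ ^ 2 ≤ 1 := pow_le_one₀ hχ0 hχ1
  have key : F ^ 2 * (χ ^ 2 * ((1 - a) * p ^ 2 - q))
      + (F * (F * (χ ^ 2 * (q - p ^ 2) + 2 * χ * χ' * p)) + 2 * (F * (G * (χ ^ 2 * p))))
      ≤ 4 * G ^ 2 + 4 * c ^ 2 * F ^ 2 := by
    nlinarith [sq_nonneg (F * χ * p - 2 * (F * χ' + χ * G)), sq_nonneg (F * χ' - χ * G),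
      mul_nonneg (sub_nonneg.mpr ha) (sq_nonneg (F * χ * p)),
      mul_nonneg (sub_nonneg.mpr h1) (sq_nonneg F), mul_nonneg (sub_nonneg.mpr h2) (sq_nonneg G)]
  nlinarith [mul_le_mul_of_nonneg_right key hm]

theorem IsWeakGradient.integral_cutoff_le (h : IsWeakGradient f g) (hV : ContDiff ℝ 2 V)
    (hfM : Integrable (fun x => f x ^ 2 * Real.exp (-V x)) volume)
    (hgM : Integrable (fun x => ‖g x‖ ^ 2 * Real.exp (-V x)) volume)
    {a K c : ℝ} (ha : 1 / 2 ≤ a) (hK : 0 ≤ K) {χ : EuclideanSpace ℝ (Fin n) → ℝ}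
    (hχ : ContDiff ℝ 1 χ) (hχc : HasCompactSupport χ) (hχ0 : ∀ x, 0 ≤ χ x) (hχ1 : ∀ x, χ x ≤ 1)
    (hc : ∀ x i, |fderiv ℝ χ x (EuclideanSpace.single i 1)| ≤ c) :
    Integrable (fun x => f x ^ 2 * (χ x ^ 2 * ((1 - a) * ‖gradient V x‖ ^ 2
        - Laplacian.laplacian V x + K)) * Real.exp (-V x)) volume ∧
    ∫ x, f x ^ 2 * (χ x ^ 2 * ((1 - a) * ‖gradient V x‖ ^ 2
        - Laplacian.laplacian V x + K)) * Real.exp (-V x)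
      ≤ 4 * (∫ x, ‖g x‖ ^ 2 * Real.exp (-V x))
        + (n * (4 * c ^ 2) + K) * ∫ x, f x ^ 2 * Real.exp (-V x) := by
  have hMc : Continuous fun x => Real.exp (-V x) := Real.continuous_exp.comp hV.continuous.neg
  have hf : ∀ r : ℝ, MemLp f 2 (volume.restrict (Metric.closedBall 0 r)) :=
    memLp_restrict_closedBall_of_integrable h.1 hMc (fun x => Real.exp_pos _)
      (by simpa using hfM)
  have hg : ∀ r : ℝ, MemLp g 2 (volume.restrict (Metric.closedBall 0 r)) :=
    memLp_restrict_closedBall_of_integrable h.2.1 hMc (fun x => Real.exp_pos _) hgM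
  have hf2 : LocallyIntegrable (fun x => f x * f x) volume := locallyIntegrable_iff.mpr
    fun k hk => by
      obtain ⟨r, hr⟩ := hk.isBounded.subset_closedBall 0
      exact IntegrableOn.mono_set ((hf r).integrable_mul (hf r)) hr
  have hfg : ∀ i, LocallyIntegrable (fun x => f x * g x i) volume := fun i =>
    locallyIntegrable_iff.mpr fun k hk => by
      obtain ⟨r, hr⟩ := hk.isBounded.subset_closedBall 0
      exact IntegrableOn.mono_set ((hf r).integrable_mul (memLp_apply (hg r) i)) hr
  set e : Fin n → EuclideanSpace ℝ (Fin n) := fun i => EuclideanSpace.single i 1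
  set η : Fin n → EuclideanSpace ℝ (Fin n) → ℝ :=
    fun i y => χ y ^ 2 * (fderiv ℝ V y (e i) * Real.exp (-V y)) with hη
  have hηs : ∀ i, ContDiff ℝ 1 (η i) := fun i => (hχ.pow 2).mul
    ((contDiff_fderiv_apply hV _).mul ((hV.of_le one_le_two).neg.exp))
  have hχ2c : HasCompactSupport fun x => χ x ^ 2 := by
    simp only [pow_two]
    exact hχc.mul_left
  have hηc : ∀ i, HasCompactSupport (η i) := fun i => hχ2c.mul_right
  have hη' : ∀ i, Continuous fun x => fderiv ℝ (η i) x (e i) := fun i =>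
    ((hηs i).continuous_fderiv one_ne_zero).clm_apply continuous_const
  have hint1 : ∀ i, Integrable (fun x => f x * (f x * fderiv ℝ (η i) x (e i))) volume := fun i => by
    refine (hf2.integrable_smul_left_of_hasCompactSupport (hη' i)
      ((hηc i).fderiv_apply ℝ _)).congr (Eventually.of_forall fun x => ?_)
    simp only [smul_eq_mul]; ring
  have hint2 : ∀ i, Integrable (fun x => f x * (g x i * η i x)) volume := fun i => by
    refine ((hfg i).integrable_smul_left_of_hasCompactSupport (hηs i).continuous
      (hηc i)).congr (Eventually.of_forall fun x => ?_)
    simp only [smul_eq_mul]; ring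
  have hint12 : ∀ i, Integrable (fun x => f x * (f x * fderiv ℝ (η i) x (e i))
      + 2 * (f x * (g x i * η i x))) volume := fun i => (hint1 i).add ((hint2 i).const_mul 2)
  have hzero : ∫ x, ∑ i, (f x * (f x * fderiv ℝ (η i) x (e i))
      + 2 * (f x * (g x i * η i x))) = 0 := by
    rw [integral_finsetSum _ fun i _ => hint12 i]
    refine Finset.sum_eq_zero fun i _ => ?_
    rw [integral_add (hint1 i) ((hint2 i).const_mul 2), integral_const_mul,
      h.integral_sq_mul_fderiv hf hg (hηs i) (hηc i) i]
    ring
  have hLint : Integrable (fun x => f x ^ 2 * (χ x ^ 2 * ((1 - a) * ‖gradient V x‖ ^ 2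
      - Laplacian.laplacian V x + K)) * Real.exp (-V x)) volume := by
    have hcont : Continuous fun x => χ x ^ 2 * (((1 - a) * ‖gradient V x‖ ^ 2
      - Laplacian.laplacian V x + K) * Real.exp (-V x)) :=
      (hχ.continuous.pow 2).mul ((((continuous_const.mul (continuous_norm_gradient_sq hV)).sub
        (continuous_laplacian hV)).add continuous_const).mul hMc)
    refine (hf2.integrable_smul_left_of_hasCompactSupport hcont hχ2c.mul_right).congr
      (Eventually.of_forall fun x => ?_)
    simp only [smul_eq_mul]; ring
  refine ⟨hLint, ?_⟩
  have hsum : Integrable (fun x => ∑ i, (f x * (f x * fderiv ℝ (η i) x (e i))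
      + 2 * (f x * (g x i * η i x)))) volume := integrable_finsetSum _ fun i _ => hint12 i
  -- Adding the vanishing integration-by-parts integral reduces the claim to a pointwise comparison
  -- of integrands.
  rw [← add_zero (∫ x, f x ^ 2 * _ * _), ← hzero, ← integral_add hLint hsum,
    ← integral_const_mul, ← integral_const_mul,
    ← integral_add (hgM.const_mul 4) (hfM.const_mul _)]
  refine integral_mono (hLint.add hsum) ((hgM.const_mul 4).add (hfM.const_mul _)) fun x => ?_
  have hm : 0 < Real.exp (-V x) := Real.exp_pos _
  have hpt := Finset.sum_le_sum fun i (_ : i ∈ Finset.univ) =>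
    energy_pointwise_le (p := fderiv ℝ V x (e i))
      (q := fderiv ℝ (fun y => fderiv ℝ V y (e i)) x (e i)) (F := f x) (G := g x i)
      ha (hχ0 x) (hχ1 x) (hc x i) hm.le
  have hKt : f x ^ 2 * (χ x ^ 2 * K) * Real.exp (-V x) ≤ K * (f x ^ 2 * Real.exp (-V x)) := by
    have h2 : χ x ^ 2 ≤ 1 := pow_le_one₀ (hχ0 x) (hχ1 x)
    nlinarith [mul_nonneg (mul_nonneg hK (sub_nonneg.mpr h2))
      (mul_nonneg (sq_nonneg (f x)) hm.le)]
  have hL : ∑ i, f x ^ 2 * (χ x ^ 2 * ((1 - a) * fderiv ℝ V x (e i) ^ 2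
      - fderiv ℝ (fun y => fderiv ℝ V y (e i)) x (e i))) * Real.exp (-V x)
      = f x ^ 2 * (χ x ^ 2 * ((1 - a) * ‖gradient V x‖ ^ 2 - Laplacian.laplacian V x))
        * Real.exp (-V x) := by
    rw [norm_gradient_sq, laplacian_eq_sum_fderiv hV, ← Finset.sum_mul, ← Finset.mul_sum,
      ← Finset.mul_sum, Finset.sum_sub_distrib, ← Finset.mul_sum]
  have hR : ∑ i, (4 * (g x i ^ 2 * Real.exp (-V x)) + 4 * c ^ 2 * (f x ^ 2 * Real.exp (-V x)))
      = 4 * (‖g x‖ ^ 2 * Real.exp (-V x))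
        + n * (4 * c ^ 2) * (f x ^ 2 * Real.exp (-V x)) := by
    rw [EuclideanSpace.real_norm_sq_eq, Finset.sum_add_distrib, ← Finset.mul_sum,
      ← Finset.sum_mul, Finset.sum_const, Finset.card_univ, Fintype.card_fin, nsmul_eq_mul]
    ring
  rw [Finset.sum_add_distrib, hL, hR] at hpt
  simp only [hη, fderiv_sq_mul_fderiv_mul_exp hV hχ]
  linarith

/-- The weighted energy estimate coming from `∫ f² ΔM = -2 ∫ f ∇f · ∇M`, `M = exp (-V)`. -/
theorem IsWeakGradient.energy_estimate (h : IsWeakGradient f g) (hV : ContDiff ℝ 2 V)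
    (hfM : Integrable (fun x => f x ^ 2 * Real.exp (-V x)) volume)
    (hgM : Integrable (fun x => ‖g x‖ ^ 2 * Real.exp (-V x)) volume)
    {a K : ℝ} (ha : 1 / 2 ≤ a) (hK : 0 ≤ K)
    (hpos : ∀ x, 0 ≤ (1 - a) * ‖gradient V x‖ ^ 2 - Laplacian.laplacian V x + K) :
    Integrable (fun x => f x ^ 2 * ((1 - a) * ‖gradient V x‖ ^ 2
        - Laplacian.laplacian V x + K) * Real.exp (-V x)) volume ∧
    ∫ x, f x ^ 2 * ((1 - a) * ‖gradient V x‖ ^ 2 - Laplacian.laplacian V x + K) * Real.exp (-V x)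
      ≤ 4 * (∫ x, ‖g x‖ ^ 2 * Real.exp (-V x)) + K * ∫ x, f x ^ 2 * Real.exp (-V x) := by
  obtain ⟨χ, c, hχ, hχc, hχ0, hχ1, hχlim, hc⟩ := exists_cutoff n
  set U : EuclideanSpace ℝ (Fin n) → ℝ :=
    fun x => (1 - a) * ‖gradient V x‖ ^ 2 - Laplacian.laplacian V x + K with hU
  have hUc : Continuous U := ((continuous_const.mul (continuous_norm_gradient_sq hV)).sub
    (continuous_laplacian hV)).add continuous_const
  have hMc : Continuous fun x => Real.exp (-V x) := Real.continuous_exp.comp hV.continuous.neg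
  set A := ∫ x, ‖g x‖ ^ 2 * Real.exp (-V x) with hA
  set B := ∫ x, f x ^ 2 * Real.exp (-V x) with hB
  have hA0 : 0 ≤ A := integral_nonneg fun x => by positivity
  have hB0 : 0 ≤ B := integral_nonneg fun x => by positivity
  have hcut := fun k => h.integral_cutoff_le hV hfM hgM ha hK
    ((hχ k).of_le (by exact_mod_cast le_top)) (hχc k) (hχ0 k) (hχ1 k) (hc k)
  have hnn : ∀ x, 0 ≤ f x ^ 2 * U x * Real.exp (-V x) := fun x =>
    mul_nonneg (mul_nonneg (sq_nonneg _) (hpos x)) (Real.exp_pos _).le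
  have hnnk : ∀ k x, 0 ≤ f x ^ 2 * (χ k x ^ 2 * U x) * Real.exp (-V x) := fun k x =>
    mul_nonneg (mul_nonneg (sq_nonneg _) (mul_nonneg (sq_nonneg _) (hpos x))) (Real.exp_pos _).le
  have hmeas : AEStronglyMeasurable (fun x => f x ^ 2 * U x * Real.exp (-V x)) volume :=
    ((h.1.aestronglyMeasurable.pow 2).mul hUc.aestronglyMeasurable).mul hMc.aestronglyMeasurable
  have hlimR : Tendsto (fun k : ℕ => 4 * A + (n * (4 * (c * (1 / ((k : ℝ) + 1))) ^ 2) + K) * B)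
      atTop (𝓝 (4 * A + K * B)) := by
    have h0 := (tendsto_one_div_add_atTop_nhds_zero_nat (𝕜 := ℝ)).const_mul c
    have h1 := (((h0.pow 2).const_mul 4).const_mul (n : ℝ)).add_const K
    have h2 := (h1.mul_const B).const_add (4 * A)
    simpa using h2
  -- Fatou applies because adding `K` made `U` nonnegative; the cutoff error is `O((k+1)⁻²)` and
  -- disappears.
  have hfatou : ∫⁻ x, ENNReal.ofReal (f x ^ 2 * U x * Real.exp (-V x))
      ≤ ENNReal.ofReal (4 * A + K * B) := by
    calc ∫⁻ x, ENNReal.ofReal (f x ^ 2 * U x * Real.exp (-V x))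
        = ∫⁻ x, liminf (fun k => ENNReal.ofReal
            (f x ^ 2 * (χ k x ^ 2 * U x) * Real.exp (-V x))) atTop := by
          refine lintegral_congr fun x => (Tendsto.liminf_eq ?_).symm
          refine tendsto_const_nhds.congr' ?_
          filter_upwards [hχlim x] with k hk
          rw [hk]; simp
      _ ≤ liminf (fun k => ∫⁻ x, ENNReal.ofReal
            (f x ^ 2 * (χ k x ^ 2 * U x) * Real.exp (-V x))) atTop :=
          lintegral_liminf_le' fun k => (hcut k).1.aestronglyMeasurable.aemeasurable.ennreal_ofReal
      _ ≤ liminf (fun k : ℕ => ENNReal.ofReal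
            (4 * A + (n * (4 * (c * (1 / ((k : ℝ) + 1))) ^ 2) + K) * B)) atTop := by
          refine liminf_le_liminf (Eventually.of_forall fun k => ?_)
          rw [← ofReal_integral_eq_lintegral_ofReal (hcut k).1 (Eventually.of_forall (hnnk k))]
          exact ENNReal.ofReal_le_ofReal (hcut k).2
      _ = ENNReal.ofReal (4 * A + K * B) := (ENNReal.tendsto_ofReal hlimR).liminf_eq
  have hInt : Integrable (fun x => f x ^ 2 * U x * Real.exp (-V x)) volume :=
    ⟨hmeas, (hasFiniteIntegral_iff_ofReal (Eventually.of_forall hnn)).mpr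
      (hfatou.trans_lt ENNReal.ofReal_lt_top)⟩
  refine ⟨hInt, ?_⟩
  rwa [← ofReal_integral_eq_lintegral_ofReal hInt (Eventually.of_forall hnn),
    ENNReal.ofReal_le_ofReal_iff (by positivity)] at hfatou


end Energy

/-! ### From the energy estimate to weighted Poincaré inequalities. -/

theorem exists_bounds_of_tendsto_cocompact {W : EuclideanSpace ℝ (Fin n) → ℝ}
    (hW : Continuous W) (hlim : Tendsto W (cocompact (EuclideanSpace ℝ (Fin n))) atTop) :
    ∃ K R : ℝ, 0 ≤ K ∧ 0 < R ∧ (∀ x, 0 ≤ W x + K) ∧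
      ∀ x, x ∉ Metric.closedBall (0 : EuclideanSpace ℝ (Fin n)) R → 1 ≤ W x := by
  obtain ⟨t, ht, hts⟩ := mem_cocompact.mp (hlim.eventually_ge_atTop 1)
  obtain ⟨r, hr⟩ := ht.isBounded.subset_closedBall (0 : EuclideanSpace ℝ (Fin n))
  have hout : ∀ x, x ∉ Metric.closedBall (0 : EuclideanSpace ℝ (Fin n)) (max r 1) → 1 ≤ W x :=
    fun x hx => hts fun hxt => hx (Metric.closedBall_subset_closedBall (le_max_left _ _) (hr hxt))
  obtain ⟨C, hC⟩ := (isCompact_closedBall (0 : EuclideanSpace ℝ (Fin n))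
    (max r 1)).exists_bound_of_continuousOn hW.continuousOn
  refine ⟨max C 0, max r 1, le_max_right _ _, by positivity, fun x => ?_, hout⟩
  by_cases hx : x ∈ Metric.closedBall (0 : EuclideanSpace ℝ (Fin n)) (max r 1)
  · have := (abs_le.mp (hC x hx)).1
    linarith [le_max_left C 0]
  · linarith [hout x hx, le_max_right C 0]

theorem integrable_sub_const_sq_mul {f M : EuclideanSpace ℝ (Fin n) → ℝ}
    (hf2 : Integrable (fun x => f x ^ 2 * M x) volume) (hf1 : Integrable (fun x => f x * M x) volume)
    (hM : Integrable M volume) (c : ℝ) :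
    Integrable (fun x => (f x - c) ^ 2 * M x) volume ∧
    ∫ x, (f x - c) ^ 2 * M x
      = (∫ x, f x ^ 2 * M x) - 2 * c * (∫ x, f x * M x) + c ^ 2 * ∫ x, M x := by
  have e : ∀ x, (f x - c) ^ 2 * M x = (f x ^ 2 * M x - 2 * c * (f x * M x)) + c ^ 2 * M x :=
    fun x => by ring
  have h1 : Integrable (fun x => 2 * c * (f x * M x)) volume := hf1.const_mul _
  have h2 : Integrable (fun x => f x ^ 2 * M x - 2 * c * (f x * M x)) volume := hf2.sub h1
  have h3 : Integrable (fun x => c ^ 2 * M x) volume := hM.const_mul _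
  simp only [e]
  exact ⟨h2.add h3, by rw [integral_add h2 h3, integral_sub hf2 h1, integral_const_mul,
    integral_const_mul]⟩

theorem integrable_mul_of_integrable_sq_mul {f M : EuclideanSpace ℝ (Fin n) → ℝ}
    (hf : AEStronglyMeasurable f volume) (hM0 : ∀ x, 0 < M x)
    (hf2 : Integrable (fun x => f x ^ 2 * M x) volume) (hM : Integrable M volume) :
    Integrable (fun x => f x * M x) volume := by
  refine (hf2.add hM).mono' (hf.mul hM.aestronglyMeasurable) (Eventually.of_forall fun x => ?_)
  rw [Real.norm_eq_abs, abs_mul, abs_of_pos (hM0 x), Pi.add_apply]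
  nlinarith [hM0 x, sq_abs (f x), mul_nonneg (sq_nonneg (|f x| - 1)) (hM0 x).le,
    mul_nonneg (sq_nonneg (f x)) (hM0 x).le]

/-- Weighted Poincaré inequality, with an unspecified constant `c` in place of the mean. -/
theorem exists_weighted_poincare {V : EuclideanSpace ℝ (Fin n) → ℝ} (hV : ContDiff ℝ 2 V)
    (hM : Integrable (fun x => Real.exp (-V x)) volume) {a K R : ℝ} (ha : 1 / 2 ≤ a)
    (hK : 0 ≤ K) (hR : 0 < R)
    (hpos : ∀ x, 0 ≤ (1 - a) * ‖gradient V x‖ ^ 2 - Laplacian.laplacian V x + K)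
    (hout : ∀ x, x ∉ Metric.closedBall (0 : EuclideanSpace ℝ (Fin n)) R →
      1 ≤ (1 - a) * ‖gradient V x‖ ^ 2 - Laplacian.laplacian V x) :
    ∃ C : ℝ, 0 ≤ C ∧ ∀ (f : EuclideanSpace ℝ (Fin n) → ℝ)
      (g : EuclideanSpace ℝ (Fin n) → EuclideanSpace ℝ (Fin n)), IsWeakGradient f g →
      Integrable (fun x => f x ^ 2 * Real.exp (-V x)) volume →
      Integrable (fun x => ‖g x‖ ^ 2 * Real.exp (-V x)) volume →
      ∃ c : ℝ, ∫ x, (f x - c) ^ 2 * Real.exp (-V x) ≤ C * ∫ x, ‖g x‖ ^ 2 * Real.exp (-V x) := by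
  have hMc : Continuous fun x => Real.exp (-V x) := Real.continuous_exp.comp hV.continuous.neg
  set B := Metric.closedBall (0 : EuclideanSpace ℝ (Fin n)) R with hB
  have hBm : MeasurableSet B := Metric.isClosed_closedBall.measurableSet
  obtain ⟨b, hb⟩ := (isCompact_closedBall (0 : EuclideanSpace ℝ (Fin n))
    R).exists_bound_of_continuousOn hV.continuous.continuousOn
  have hMle : ∀ x ∈ B, Real.exp (-V x) ≤ Real.exp b := fun x hx =>
    Real.exp_le_exp.mpr (by linarith [(abs_le.mp (hb x hx)).1])
  have hleM : ∀ x ∈ B, 1 ≤ Real.exp b * Real.exp (-V x) := fun x hx => by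
    rw [← Real.exp_add]
    exact Real.one_le_exp (by linarith [(abs_le.mp (hb x hx)).2])
  set P : ℝ := 2 ^ (n + 1) * R ^ 2 with hP
  have hP0 : 0 ≤ P := by positivity
  refine ⟨4 + (1 + K) * (Real.exp b * P * Real.exp b), by positivity, fun f g h hfM hgM => ?_⟩
  have hf : ∀ r : ℝ, MemLp f 2 (volume.restrict (Metric.closedBall 0 r)) :=
    memLp_restrict_closedBall_of_integrable h.1 hMc (fun x => Real.exp_pos _)
      (by simpa using hfM)
  have hg : ∀ r : ℝ, MemLp g 2 (volume.restrict (Metric.closedBall 0 r)) :=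
    memLp_restrict_closedBall_of_integrable h.2.1 hMc (fun x => Real.exp_pos _) hgM
  obtain ⟨c, hc⟩ := h.poincare_closedBall hf hg hR
  refine ⟨c, ?_⟩
  have hfM1 := integrable_mul_of_integrable_sq_mul h.1.aestronglyMeasurable
    (fun x => Real.exp_pos (-V x)) hfM hM
  have hhM := (integrable_sub_const_sq_mul hfM hfM1 hM c).1
  obtain ⟨hE, hEle⟩ := (h.sub_const c).energy_estimate hV hhM hgM ha hK hpos
  set A := ∫ x, ‖g x‖ ^ 2 * Real.exp (-V x) with hA
  have hhL : IntegrableOn (fun x => (f x - c) ^ 2) B volume := by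
    have : IsFiniteMeasure (volume.restrict B) :=
      ⟨by simpa using (isCompact_closedBall (0 : EuclideanSpace ℝ (Fin n)) R).measure_lt_top⟩
    exact ((hf R).sub (memLp_const c)).integrable_sq
  have hgL : IntegrableOn (fun x => ‖g x‖ ^ 2) B volume := (hg R).norm.integrable_sq
  have hin : ∫ x in B, (f x - c) ^ 2 * Real.exp (-V x) ≤ Real.exp b * P * Real.exp b * A := by
    calc ∫ x in B, (f x - c) ^ 2 * Real.exp (-V x)
        ≤ ∫ x in B, Real.exp b * (f x - c) ^ 2 :=
          setIntegral_mono_on hhM.integrableOn (hhL.const_mul _) hBm fun x hx => by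
            rw [mul_comm]
            exact mul_le_mul_of_nonneg_right (hMle x hx) (sq_nonneg _)
      _ ≤ Real.exp b * (P * ∫ x in B, ‖g x‖ ^ 2) := by
          rw [integral_const_mul]; gcongr
      _ ≤ Real.exp b * (P * ∫ x in B, Real.exp b * (‖g x‖ ^ 2 * Real.exp (-V x))) := by
          refine mul_le_mul_of_nonneg_left (mul_le_mul_of_nonneg_left ?_ hP0) (Real.exp_pos b).le
          refine setIntegral_mono_on hgL (hgM.integrableOn.const_mul _) hBm fun x hx => ?_
          nlinarith [mul_le_mul_of_nonneg_left (hleM x hx) (sq_nonneg ‖g x‖)]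
      _ ≤ Real.exp b * (P * (Real.exp b * A)) := by
          rw [integral_const_mul]
          gcongr
          exact setIntegral_le_integral hgM (Eventually.of_forall fun x => by positivity)
      _ = _ := by ring
  -- Outside the ball the weight is at least `1 + K`, which beats the `K` on the right of the energy
  -- estimate: `T ≤ 4A + (1 + K) T_B`, with `T` the total integral and `T_B` its part over the ball.
  have hlow : (1 + K) * ((∫ x, (f x - c) ^ 2 * Real.exp (-V x))
      - ∫ x in B, (f x - c) ^ 2 * Real.exp (-V x))
      ≤ ∫ x, (f x - c) ^ 2 * ((1 - a) * ‖gradient V x‖ ^ 2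
        - Laplacian.laplacian V x + K) * Real.exp (-V x) := by
    rw [← integral_add_compl hBm hhM, add_sub_cancel_left, ← integral_const_mul]
    calc _ ≤ ∫ x in Bᶜ, (f x - c) ^ 2 * ((1 - a) * ‖gradient V x‖ ^ 2
        - Laplacian.laplacian V x + K) * Real.exp (-V x) := by
          refine setIntegral_mono_on (hhM.integrableOn.const_mul _) hE.integrableOn hBm.compl
            fun x hx => ?_
          have h0 : 0 ≤ (f x - c) ^ 2 * Real.exp (-V x) := by positivity
          nlinarith [mul_le_mul_of_nonneg_left (hout x hx) h0]
      _ ≤ _ := setIntegral_le_integral hE (Eventually.of_forall fun x =>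
          mul_nonneg (mul_nonneg (sq_nonneg _) (hpos x)) (Real.exp_pos _).le)
  have hK1 := mul_le_mul_of_nonneg_left hin (by linarith : 0 ≤ 1 + K)
  linarith

theorem norm_gradient_neg (V : EuclideanSpace ℝ (Fin n) → ℝ) (x : EuclideanSpace ℝ (Fin n)) :
    ‖gradient (fun y => -V y) x‖ = ‖gradient V x‖ := by
  rw [gradient, gradient, fderiv_fun_neg, map_neg, norm_neg]

/-- Poincaré inequality with the improved weight `1 + ‖∇V‖²`, for `M = exp (-V)`. -/
theorem exists_improved_weighted_poincare {V : EuclideanSpace ℝ (Fin n) → ℝ}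
    (hV : ContDiff ℝ 2 V) (hM : Integrable (fun x => Real.exp (-V x)) volume) {ε : ℝ}
    (hε : 0 < ε) (hlim : Tendsto
      (fun x => (1 - ε) * ‖gradient V x‖ ^ 2 / 2 - Laplacian.laplacian V x)
        (cocompact (EuclideanSpace ℝ (Fin n))) atTop) :
    ∃ C : ℝ, 0 < C ∧ ∀ (f : EuclideanSpace ℝ (Fin n) → ℝ)
      (g : EuclideanSpace ℝ (Fin n) → EuclideanSpace ℝ (Fin n)), IsWeakGradient f g →
      Integrable (fun x => f x ^ 2 * Real.exp (-V x)) volume →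
      Integrable (fun x => ‖g x‖ ^ 2 * Real.exp (-V x)) volume →
      ∫ x, f x * Real.exp (-V x) = 0 →
      Integrable (fun x => f x ^ 2 * (1 + ‖gradient V x‖ ^ 2) * Real.exp (-V x)) volume ∧
      ∫ x, f x ^ 2 * (1 + ‖gradient V x‖ ^ 2) * Real.exp (-V x)
        ≤ C * ∫ x, ‖g x‖ ^ 2 * Real.exp (-V x) := by
  have hWc : Continuous fun x => (1 - ε) * ‖gradient V x‖ ^ 2 / 2 - Laplacian.laplacian V x :=
    ((continuous_const.mul (continuous_norm_gradient_sq hV)).div_const 2).sub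
      (continuous_laplacian hV)
  obtain ⟨K, R, hK, hR, hWK, hW1⟩ := exists_bounds_of_tendsto_cocompact hWc hlim
  -- Half of the margin `ε/2` goes to Young's inequality; the other half leaves `(ε/4)|∇V|²` beyond
  -- `W`.
  set a : ℝ := 1 / 2 + ε / 4 with ha
  have ha2 : 1 / 2 ≤ a := by rw [ha]; linarith
  have hsplit : ∀ x, (1 - a) * ‖gradient V x‖ ^ 2 - Laplacian.laplacian V x
      = ((1 - ε) * ‖gradient V x‖ ^ 2 / 2 - Laplacian.laplacian V x)
        + ε / 4 * ‖gradient V x‖ ^ 2 := fun x => by rw [ha]; ring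
  have hp0 : ∀ x, 0 ≤ ε / 4 * ‖gradient V x‖ ^ 2 := fun x => by positivity
  have hlow : ∀ x, ε / 4 * ‖gradient V x‖ ^ 2
      ≤ (1 - a) * ‖gradient V x‖ ^ 2 - Laplacian.laplacian V x + K := fun x => by
    rw [hsplit]; linarith [hWK x]
  have hpos : ∀ x, 0 ≤ (1 - a) * ‖gradient V x‖ ^ 2 - Laplacian.laplacian V x + K :=
    fun x => (hp0 x).trans (hlow x)
  obtain ⟨C, hC, hpoin⟩ := exists_weighted_poincare hV hM ha2 hK hR hpos
    fun x hx => by rw [hsplit]; linarith [hW1 x hx, hp0 x]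
  refine ⟨C + 4 / ε * (4 + K * C), by positivity, fun f g h hfM hgM hmean => ?_⟩
  obtain ⟨c, hc⟩ := hpoin f g h hfM hgM
  have hfM1 := integrable_mul_of_integrable_sq_mul h.1.aestronglyMeasurable
    (fun x => Real.exp_pos (-V x)) hfM hM
  rw [(integrable_sub_const_sq_mul hfM hfM1 hM c).2, hmean] at hc
  -- With mean zero, `∫ (f - c)² M = ∫ f² M + c² ∫ M`, so the unspecified `c` can be dropped.
  have hM0 : 0 ≤ c ^ 2 * ∫ x, Real.exp (-V x) :=
    mul_nonneg (sq_nonneg _) (integral_nonneg fun x => (Real.exp_pos _).le)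
  obtain ⟨hE, hEle⟩ := h.energy_estimate hV hfM hgM ha2 hK hpos
  set A := ∫ x, ‖g x‖ ^ 2 * Real.exp (-V x) with hA
  set D := ∫ x, f x ^ 2 * Real.exp (-V x) with hD
  have hD : D ≤ C * A := by linarith
  have hpt : ∀ x, f x ^ 2 * ‖gradient V x‖ ^ 2 * Real.exp (-V x)
      ≤ 4 / ε * (f x ^ 2 * ((1 - a) * ‖gradient V x‖ ^ 2
        - Laplacian.laplacian V x + K) * Real.exp (-V x)) := fun x => by
    have h0 : 0 ≤ f x ^ 2 * Real.exp (-V x) := by positivity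
    have h1 := mul_le_mul_of_nonneg_left (mul_le_mul_of_nonneg_left (hlow x) h0)
      (by positivity : 0 ≤ 4 / ε)
    have h2 : 4 / ε * (f x ^ 2 * Real.exp (-V x) * (ε / 4 * ‖gradient V x‖ ^ 2))
        = f x ^ 2 * ‖gradient V x‖ ^ 2 * Real.exp (-V x) := by field_simp
    rw [h2] at h1
    exact h1.trans (le_of_eq (by ring))
  have hI : Integrable (fun x => f x ^ 2 * ‖gradient V x‖ ^ 2 * Real.exp (-V x)) volume := by
    refine (hE.const_mul (4 / ε)).mono' ?_ (Eventually.of_forall fun x => ?_)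
    · exact ((h.1.aestronglyMeasurable.pow 2).mul
        (continuous_norm_gradient_sq hV).aestronglyMeasurable).mul hM.aestronglyMeasurable
    · rw [Real.norm_of_nonneg (by positivity)]
      exact hpt x
  have hIle : ∫ x, f x ^ 2 * ‖gradient V x‖ ^ 2 * Real.exp (-V x) ≤ 4 / ε * (4 * A + K * D) := by
    refine (integral_mono hI (hE.const_mul _) hpt).trans ?_
    rw [integral_const_mul]
    gcongr
  have e : ∀ x, f x ^ 2 * (1 + ‖gradient V x‖ ^ 2) * Real.exp (-V x)
      = f x ^ 2 * Real.exp (-V x) + f x ^ 2 * ‖gradient V x‖ ^ 2 * Real.exp (-V x) :=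
    fun x => by ring
  simp only [e]
  refine ⟨hfM.add hI, ?_⟩
  rw [integral_add hfM hI]
  have h3 : 4 / ε * (4 * A + K * D) ≤ 4 / ε * (4 * A + K * (C * A)) := by gcongr
  linarith

end WeightedSobolev

/-! ### The main theorem. -/

theorem proposition1 {n : ℕ} (M V : EuclideanSpace ℝ (Fin n) → ℝ)
    (hMV : ∀ x, M x = Real.exp (-V x))
    (hM_smooth : ContDiff ℝ 2 M)
    (hM_int : Integrable M volume)
    (hV : ∃ ε : ℝ, 0 < ε ∧
      Tendsto (fun x => (1 - ε) * ‖gradient V x‖ ^ 2 / 2 - Laplacian.laplacian V x)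
        (cocompact (EuclideanSpace ℝ (Fin n))) atTop) :
    ∃ lam : ℝ, 0 < lam ∧
      ∀ f : EuclideanSpace ℝ (Fin n) → ℝ,
        WeightedSobolev.MemL20 M f → WeightedSobolev.MemH1 M f →
        ∀ g : EuclideanSpace ℝ (Fin n) → EuclideanSpace ℝ (Fin n),
          WeightedSobolev.IsWeakGradient f g →
          Integrable (fun x => ‖g x‖ ^ 2 * M x) volume ∧
          Integrable
            (fun x => f x ^ 2 * (1 + ‖gradient (fun y => Real.log (M y)) x‖ ^ 2) * M x) volume ∧
          lam * ∫ x, f x ^ 2 * (1 + ‖gradient (fun y => Real.log (M y)) x‖ ^ 2) * M x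
            ≤ ∫ x, ‖g x‖ ^ 2 * M x := by
  obtain ⟨ε, hε, hlim⟩ := hV
  obtain rfl : M = fun x => Real.exp (-V x) := funext hMV
  have hM0 : ∀ x, 0 < Real.exp (-V x) := fun x => Real.exp_pos _
  -- Regularity is assumed for `M` only; it passes to `V = -log M` by positivity.
  have hVs : ContDiff ℝ 2 V := by
    have h := (hM_smooth.log fun x => (hM0 x).ne').neg
    simpa only [Real.log_exp, neg_neg] using h
  obtain ⟨C, hC, hmain⟩ :=
    WeightedSobolev.exists_improved_weighted_poincare hVs hM_int hε hlim
  refine ⟨C⁻¹, inv_pos.mpr hC, ?_⟩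
  rintro f ⟨hf, hmean⟩ ⟨-, g', hg', hg'L⟩ g hg
  have hMc : Continuous fun x => Real.exp (-V x) := hM_smooth.continuous
  have hfM : Integrable (fun x => f x ^ 2 * Real.exp (-V x)) volume := by
    simpa using WeightedSobolev.integrable_sq_mul_of_memLp hMc hM0 hf
  have hgM : Integrable (fun x => ‖g x‖ ^ 2 * Real.exp (-V x)) volume := by
    refine (WeightedSobolev.integrable_sq_mul_of_memLp hMc hM0 hg'L).congr ?_
    filter_upwards [hg'.ae_unique hg] with x hx
    rw [hx]
  obtain ⟨hI, hle⟩ := hmain f g hg hfM hgM hmean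
  simp only [Real.log_exp, WeightedSobolev.norm_gradient_neg]
  exact ⟨hgM, hI, by rwa [inv_mul_le_iff₀ hC]⟩
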